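/- Let $\mathbb H$ be the quaternions, $\mathbb S=\{I\in\mathbb H: I^2=-1\}$, $L_I=\mathbb R+I\mathbb R$ for $I\in\mathbb S$, and $x+y\mathbb S=\{x+yI: I\in\mathbb S\}$ for $x,y\in\mathbb R$ (a $2$-sphere, or a real point if $y=0$). A *symmetric slice domain* is a connected nonempty open set $\Omega\subseteq\mathbb H$ that contains $x+y\mathbb S$ whenever it contains one point of it, that meets $\mathbb R$, and for which $\Omega_I=\Omega\cap L_I$ is connected for every $I\in\mathbb S$. A function $f$ on an open set is *regular* if for all $I\in\mathbb S$ its restriction to $L_I$ is (real) differentiable and satisfies $(\partial_x+I\partial_y)f(x+Iy)=0$. Let $f$ be regular on a symmetric slice domain $\Omega'$. A point $p$ is a *singularity* of $f$ if for $I\in\mathbb S$ with $p\in L_I$ there are $R>0$ and $a_n\in\mathbb H$ such that every $z\in L_I$ with $0<|z-p|<R$ lies in $\Omega'$ and $f(z)=\sum_{n\in\mathbb Z}(z-p)^na_n$. It is *removable* if some regular function on an open neighbourhood $N$ of $p$ equals $f$ on $N\cap\Omega'$; it is a *pole* if it is not removable and there is $m\ge 0$ with $a_{-k}=0$ for all $k>m$.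 The function $f$ is *semiregular* on a symmetric slice domain $\Omega\supseteq\Omega'$ if every point of $\Omega\setminus\Omega'$ is a pole or a removable singularity of $f$. A semiregular $f$ on $\Omega$ has *principal part* $P$ at $x_0+y_0\mathbb S\subset\Omega$ if for every $q_0\in x_0+y_0\mathbb S$ there are $k\ge0$, $R>0$ and $B_j\in\mathbb H$, with $k=0$ or $(B_0,B_1)\neq(0,0)$, such that every $q\notin x_0+y_0\mathbb S$ with $|(q-x_0)^2+y_0^2|<R^2$ lies in $\Omega'$ and $$f(q)=\sum_{j\ge0}((q-x_0)^2+y_0^2)^{j-k}[B_{2j}+(q-q_0)B_{2j+1}],$$ and such that for all $q\notin x_0+y_0\mathbb S$ $$P(q)=\sum_{n=1}^{k}((q-x_0)^2+y_0^2)^{-n}[B_{2(k-n)}+(q-q_0)B_{2(k-n)+1}].$$ (In particular $P=0$ if $f$ has no pole on the sphere.) **Theorem.** Let $\Omega\subseteq\mathbb H$ be a symmetric slice domain and let $\{x_\alpha+y_\alpha\mathbb S\}_{\alpha\in A}$ be pairwise distinct spheres (or real points) contained in $\Omega$ which form a closed and discrete set: their union is closed in $\Omega$, and each of them has an open neighbourhood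 that meets none of the others. For every $\alpha\in A$ let $q_\alpha\in x_\alpha+y_\alpha\mathbb S$, $m(\alpha)\in\mathbb N$ (possibly $0$), $A_{\alpha,j}\in\mathbb H$ for $2\le j\le 2m(\alpha)+1$, and $$P_\alpha(q)=\sum_{n=1}^{m(\alpha)}((q-x_\alpha)^2+y_\alpha^2)^{-n}[A_{\alpha,2n}+(q-q_\alpha)A_{\alpha,2n+1}].$$ Then there exists a function $f$ semiregular on $\Omega$ such that for every $\alpha\in A$ the principal part of $f$ at $x_\alpha+y_\alpha\mathbb S$ is $P_\alpha$, and every pole of $f$ in $\Omega$ lies in $\bigcup_{\alpha\in A}(x_\alpha+y_\alpha\mathbb S)$. -/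

import Mathlib

open scoped Quaternion

noncomputable section

namespace SliceRegular

/-- The `2`-sphere of quaternionic imaginary units. -/
def imaginaryUnits : Set ℍ[ℝ] := {I | I ^ 2 = -1}

/-- The complex plane `ℝ + Iℝ`. -/
def slicePlane (I : ℍ[ℝ]) : Set ℍ[ℝ] :=
  {q | ∃ x y : ℝ, q = (x : ℍ[ℝ]) + I * (y : ℍ[ℝ])}

/-- The set `x + y𝕊`: a `2`-sphere if `y ≠ 0`, the real point `x` if `y = 0`. -/
def sphere (x y : ℝ) : Set ℍ[ℝ] :=
  {q | ∃ I ∈ imaginaryUnits, q = (x : ℍ[ℝ]) + I * (y : ℍ[ℝ])}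

/-- Symmetric slice domains: open connected sets which are unions of sets `x + y𝕊`, meet the real
axis, and meet every plane `ℝ + Iℝ` in a connected (relatively open, nonempty) set. -/
structure IsSymmetricSliceDomain (Ω : Set ℍ[ℝ]) : Prop where
  isOpen : IsOpen Ω
  isConnected : IsConnected Ω
  symmetric : ∀ (x y : ℝ), ∀ I ∈ imaginaryUnits,
    (x : ℍ[ℝ]) + I * (y : ℍ[ℝ]) ∈ Ω → sphere x y ⊆ Ω
  meets_real : ∃ x : ℝ, (x : ℍ[ℝ]) ∈ Ω
  slice_isConnected : ∀ I ∈ imaginaryUnits, IsConnected (Ω ∩ slicePlane I)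

/-- Slice regularity on an open set `Ω`: for every imaginary unit `I`, the restriction
`(x, y) ↦ f (x + I y)` is (real) differentiable at the points over `Ω` and satisfies
`(∂/∂x + I ∂/∂y) f = 0` there. -/
def IsRegularOn (f : ℍ[ℝ] → ℍ[ℝ]) (Ω : Set ℍ[ℝ]) : Prop :=
  ∀ I ∈ imaginaryUnits, ∀ x y : ℝ, (x : ℍ[ℝ]) + I * (y : ℍ[ℝ]) ∈ Ω →
    ∃ D : ℝ × ℝ →L[ℝ] ℍ[ℝ],
      HasFDerivAt (fun p : ℝ × ℝ => f ((p.1 : ℍ[ℝ]) + I * (p.2 : ℍ[ℝ]))) D (x, y) ∧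
        D (1, 0) + I * D (0, 1) = 0

/-- The function `f`, defined on `Ω'`, has on the plane `ℝ + Iℝ` the Laurent expansion
`∑ (z - p)^n a_n`, `n ∈ ℤ`, in some punctured disc centred at `p` (contained in `Ω'`). -/
def HasLaurentExpansion (f : ℍ[ℝ] → ℍ[ℝ]) (Ω' : Set ℍ[ℝ]) (I p : ℍ[ℝ]) (a : ℤ → ℍ[ℝ]) : Prop :=
  ∃ R : ℝ, 0 < R ∧ ∀ z ∈ slicePlane I, 0 < ‖z - p‖ → ‖z - p‖ < R →
    z ∈ Ω' ∧ HasSum (fun n : ℤ => (z - p) ^ n * a n) (f z)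

/-- `p` is a singularity of `f : Ω' → ℍ`. (The plane through `p` is unique unless `p` is real.) -/
def IsSingularity (f : ℍ[ℝ] → ℍ[ℝ]) (Ω' : Set ℍ[ℝ]) (p : ℍ[ℝ]) : Prop :=
  ∀ I ∈ imaginaryUnits, p ∈ slicePlane I → ∃ a : ℤ → ℍ[ℝ], HasLaurentExpansion f Ω' I p a

/-- `f : Ω' → ℍ` extends to a neighbourhood of `p` as a regular function. -/
def ExtendsRegularlyAt (f : ℍ[ℝ] → ℍ[ℝ]) (Ω' : Set ℍ[ℝ]) (p : ℍ[ℝ]) : Prop :=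
  ∃ (N : Set ℍ[ℝ]) (g : ℍ[ℝ] → ℍ[ℝ]),
    IsOpen N ∧ p ∈ N ∧ IsRegularOn g N ∧ ∀ q ∈ N ∩ Ω', g q = f q

/-- `p` is a removable singularity of `f : Ω' → ℍ`. -/
def IsRemovableSingularity (f : ℍ[ℝ] → ℍ[ℝ]) (Ω' : Set ℍ[ℝ]) (p : ℍ[ℝ]) : Prop :=
  IsSingularity f Ω' p ∧ ExtendsRegularlyAt f Ω' p

/-- `p` is a pole of `f : Ω' → ℍ`: a singularity which is not removable and at which the Laurent
expansion has only finitely many terms of negative degree. There may be none, since a nonremovable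
singular sphere may contain one point at which the expansion on the plane through it is regular. -/
def IsPole (f : ℍ[ℝ] → ℍ[ℝ]) (Ω' : Set ℍ[ℝ]) (p : ℍ[ℝ]) : Prop :=
  ¬ ExtendsRegularlyAt f Ω' p ∧
    ∀ I ∈ imaginaryUnits, p ∈ slicePlane I →
      ∃ (a : ℤ → ℍ[ℝ]) (m : ℕ), HasLaurentExpansion f Ω' I p a ∧ ∀ k : ℕ, m < k → a (-(k : ℤ)) = 0

/-- `f`, defined and regular on the symmetric slice domain `Ω' ⊆ Ω`, is semiregular on `Ω`. The
values of `f` outside `Ω'` play no role. -/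
structure IsSemiregularOn (f : ℍ[ℝ] → ℍ[ℝ]) (Ω' Ω : Set ℍ[ℝ]) : Prop where
  domain : IsSymmetricSliceDomain Ω'
  subset : Ω' ⊆ Ω
  regular : IsRegularOn f Ω'
  pole_or_removable : ∀ p ∈ Ω \ Ω', IsPole f Ω' p ∨ IsRemovableSingularity f Ω' p

/-- The function `q ↦ ((q - x)² + y²)^n [a + (q - q₀) b]`, with `n` an integer. -/
def sphericalTerm (x y : ℝ) (q₀ : ℍ[ℝ]) (n : ℤ) (a b q : ℍ[ℝ]) : ℍ[ℝ] :=
  ((q - (x : ℍ[ℝ])) ^ 2 + (y : ℍ[ℝ]) ^ 2) ^ n * (a + (q - q₀) * b)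

/-- The symmetric neighbourhood `U(x + y𝕊, R)` of `x + y𝕊`. -/
def sphereNhd (x y R : ℝ) : Set ℍ[ℝ] :=
  {q | ‖(q - (x : ℍ[ℝ])) ^ 2 + (y : ℍ[ℝ]) ^ 2‖ < R ^ 2}

/-- The spherical Laurent expansion
`f(q) = ∑_{j ≥ 0} ((q - x)² + y²)^(j - k) [A_{2j} + (q - q₀) A_{2j+1}]` of `f : Ω' → ℍ`, valid
on some `U(x + y𝕊, R)` minus `x + y𝕊`. The last clause says that `2k` is the
spherical order of `f` at `x + y𝕊` (with `k = 0` if there is no pole). -/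
def HasSphericalLaurentSeries (f : ℍ[ℝ] → ℍ[ℝ]) (Ω' : Set ℍ[ℝ]) (x y : ℝ) (q₀ : ℍ[ℝ])
    (k : ℕ) (A : ℕ → ℍ[ℝ]) : Prop :=
  (∃ R : ℝ, 0 < R ∧ ∀ q ∈ sphereNhd x y R \ sphere x y,
    q ∈ Ω' ∧
      HasSum (fun j : ℕ => sphericalTerm x y q₀ ((j : ℤ) - (k : ℤ)) (A (2 * j)) (A (2 * j + 1)) q)
        (f q)) ∧
  (k = 0 ∨ A 0 ≠ 0 ∨ A 1 ≠ 0)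

/-- The function `P`, defined off `x + y𝕊`, is the principal part of `f : Ω' → ℍ` at `x + y𝕊`,
computed from the spherical Laurent series with respect to any point `q₀` of `x + y𝕊`. -/
def HasPrincipalPart (f : ℍ[ℝ] → ℍ[ℝ]) (Ω' : Set ℍ[ℝ]) (x y : ℝ) (P : ℍ[ℝ] → ℍ[ℝ]) : Prop :=
  ∀ q₀ ∈ sphere x y, ∃ (k : ℕ) (A : ℕ → ℍ[ℝ]), HasSphericalLaurentSeries f Ω' x y q₀ k A ∧
    ∀ q ∉ sphere x y, P q = ∑ n ∈ Finset.Icc 1 k,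
      sphericalTerm x y q₀ (-(n : ℤ)) (A (2 * (k - n))) (A (2 * (k - n) + 1)) q

/-- The sets `x_α + y_α𝕊` are pairwise distinct, contained in `Ω`, and form a closed
(relative to `Ω`) and discrete set of spheres (or real points). -/
structure IsClosedDiscreteFamily {ι : Type*} (Ω : Set ℍ[ℝ]) (x y : ι → ℝ) : Prop where
  injective : Function.Injective (fun α => sphere (x α) (y α))
  subset : ∀ α, sphere (x α) (y α) ⊆ Ω
  closed : ∃ C : Set ℍ[ℝ], IsClosed C ∧ ⋃ α, sphere (x α) (y α) = Ω ∩ C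
  discrete : ∀ α, ∃ V : Set ℍ[ℝ], IsOpen V ∧ sphere (x α) (y α) ⊆ V ∧
    ∀ β, β ≠ α → Disjoint V (sphere (x β) (y β))

end SliceRegular

end

namespace SliceRegular

open Set Metric Filter Topology ComplexConjugate

/-! The problem reduces to four problems over `ℂ` with real coefficients. A complex function with
h(conj z) = conj (h z) induces x + Iy ↦ Re h + I Im h consistently on all slices (`sliceExt`), and
right multiplication by constants preserves regularity. Quaternionic coefficients stand on the
right, so a prescribed principal part, once recentred from q_α to the real point x_α, splits along
1, i, j, k into four complex principal parts in (z - x)² + y² with real coefficients.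
`exists_mittagLeffler` solves each of them on the plane open set lying under Ω, and `stemExt`
reassembles the solutions.

The complex theorem rests on `exists_approximation_sets`: a simple pole at a is a uniform limit of
functions holomorphic on D, on a set that contains any given compact set once a is near the boundary
or infinity. Subtracting approximants with summable errors makes the sum of the principal parts
converge, and symmetrization restores compatibility with conjugation. Removing the α-th principal
part leaves a function holomorphic near the α-th pair of roots. `exists_hasSum_quad` expands it in
powers of the quadratic polynomial, so the principal part can be read off
(`hasPrincipalPart_of_hasSum`).

The solution lives on Ω minus all the spheres, which is still a symmetric slice domain because a
countable set does not disconnect a plane domain. At each removed point the Laurent expansion has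
finitely many negative terms, so the point is removable or a pole according to whether a regular
extension exists. -/

/-! ### Plane domains with a countable set removed -/

/-- Removing a countable set from a disc in the plane leaves a
preconnected set. -/
theorem isPreconnected_ball_diff_countable (c : ℂ) (r : ℝ) {Z : Set ℂ} (hZ : Z.Countable) :
    IsPreconnected (ball c r \ Z) := by
  rcases le_or_gt r 0 with hr | hr
  · simp [ball_eq_empty.2 hr, isPreconnected_empty]
  let e := OpenPartialHomeomorph.univBall c r
  have hinj : Function.Injective e := by
    have := e.injOn
    rwa [OpenPartialHomeomorph.univBall_source, injOn_univ] at this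
  have himg : range e = ball c r := by
    rw [← image_univ, ← OpenPartialHomeomorph.univBall_source c r, e.image_source_eq_target,
      OpenPartialHomeomorph.univBall_target c hr]
  have hcount : (e ⁻¹' Z).Countable := hZ.preimage hinj
  have hconn := (hcount.isConnected_compl_of_one_lt_rank
    (by rw [Complex.rank_real_complex]; norm_num)).isPreconnected
  have hcont : Continuous e := OpenPartialHomeomorph.continuous_univBall c r
  have : ball c r \ Z = e '' (e ⁻¹' Z)ᶜ := by
    rw [← preimage_compl, image_preimage_eq_inter_range, himg, inter_comm, sdiff_eq]
  rw [this]
  exact hconn.image _ hcont.continuousOn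

theorem dense_compl_of_countable {Z : Set ℂ} (hZ : Z.Countable) : Dense Zᶜ :=
  hZ.dense_compl ℝ

/-- Removing a countable set from a connected open plane set leaves a connected set. -/
theorem isPreconnected_diff_countable {s Z : Set ℂ} (hs : IsOpen s) (hc : IsPreconnected s)
    (hZ : Z.Countable) : IsPreconnected (s \ Z) := by
  rw [isPreconnected_iff_subset_of_disjoint]
  intro u v hu hv hsuv hdisj
  -- A separation of `s \ Z` by `u`, `v` extends to one of `s` by `W u`, `W v`. These cover `s` by
  -- the case of discs, and they cannot overlap because a nonempty open set has points off `Z`.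
  let W : Set ℂ → Set ℂ := fun w => ⋃₀ {B | IsOpen B ∧ B ⊆ s ∧ B \ Z ⊆ w}
  have hWopen : ∀ w, IsOpen (W w) := fun w => isOpen_sUnion fun B hB => hB.1
  have hcover : s ⊆ W u ∪ W v := by
    intro p hp
    obtain ⟨r, hr, hrs⟩ := Metric.isOpen_iff.1 hs p hp
    have hB := isPreconnected_iff_subset_of_disjoint.1
      (isPreconnected_ball_diff_countable p r hZ) u v hu hv
      ((sdiff_subset_sdiff_left hrs).trans hsuv)
      (subset_empty_iff.1 (hdisj ▸ inter_subset_inter_left _ (sdiff_subset_sdiff_left hrs)))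
    rcases hB with h | h
    · exact Or.inl ⟨ball p r, ⟨isOpen_ball, hrs, h⟩, mem_ball_self hr⟩
    · exact Or.inr ⟨ball p r, ⟨isOpen_ball, hrs, h⟩, mem_ball_self hr⟩
  have hempty : s ∩ (W u ∩ W v) = ∅ := by
    rw [eq_empty_iff_forall_notMem]
    rintro p ⟨-, ⟨B, ⟨hB, hBs, hBu⟩, hpB⟩, ⟨B', ⟨hB', -, hBv⟩, hpB'⟩⟩
    obtain ⟨a, ⟨haB, haB'⟩, haZ⟩ :=
      (dense_compl_of_countable hZ).inter_open_nonempty _ (hB.inter hB') ⟨p, hpB, hpB'⟩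
    have : a ∈ s \ Z ∩ (u ∩ v) := ⟨⟨hBs haB, haZ⟩, hBu ⟨haB, haZ⟩, hBv ⟨haB', haZ⟩⟩
    rw [hdisj] at this
    exact this
  have hW : ∀ w, s ⊆ W w → s \ Z ⊆ w := by
    rintro w h p ⟨hp, hpZ⟩
    obtain ⟨B, ⟨-, -, hBw⟩, hpB⟩ := h hp
    exact hBw ⟨hpB, hpZ⟩
  exact (isPreconnected_iff_subset_of_disjoint.1 hc _ _ (hWopen u) (hWopen v) hcover hempty).imp
    (hW u) (hW v)

/-! ### Uniform approximation of poles by functions holomorphic on `D` -/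

/-- The function `g` is bounded on `G` and a uniform limit on `G` of functions holomorphic
on `D`. -/
structure IsBoundedLimit (D G : Set ℂ) (g : ℂ → ℂ) : Prop where
  bounded : ∃ M : ℝ, 0 < M ∧ ∀ z ∈ G, ‖g z‖ ≤ M
  approx : ∀ ε : ℝ, 0 < ε → ∃ r : ℂ → ℂ, DifferentiableOn ℂ r D ∧ ∀ z ∈ G, ‖g z - r z‖ ≤ ε

namespace IsBoundedLimit

variable {D G : Set ℂ} {g g₁ g₂ : ℂ → ℂ}

theorem of_differentiableOn (hg : DifferentiableOn ℂ g D) {M : ℝ} (hM : ∀ z ∈ G, ‖g z‖ ≤ M) :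
    IsBoundedLimit D G g :=
  ⟨⟨max M 1, by positivity, fun z hz => (hM z hz).trans (le_max_left _ _)⟩,
    fun ε hε => ⟨g, hg, fun z _ => by simpa using hε.le⟩⟩

theorem const (c : ℂ) : IsBoundedLimit D G fun _ => c :=
  of_differentiableOn (differentiableOn_const c) fun _ _ => le_rfl

theorem mono {G' : Set ℂ} (h : IsBoundedLimit D G g) (hG : G' ⊆ G) : IsBoundedLimit D G' g := by
  obtain ⟨⟨M, hM, hb⟩, ha⟩ := h
  refine ⟨⟨M, hM, fun z hz => hb z (hG hz)⟩, fun ε hε => ?_⟩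
  obtain ⟨r, hr, hr'⟩ := ha ε hε
  exact ⟨r, hr, fun z hz => hr' z (hG hz)⟩

theorem congr (h : IsBoundedLimit D G g₁) (hg : ∀ z ∈ G, g₁ z = g₂ z) :
    IsBoundedLimit D G g₂ := by
  obtain ⟨⟨M, hM, hb⟩, ha⟩ := h
  refine ⟨⟨M, hM, fun z hz => hg z hz ▸ hb z hz⟩, fun ε hε => ?_⟩
  obtain ⟨r, hr, hr'⟩ := ha ε hε
  exact ⟨r, hr, fun z hz => hg z hz ▸ hr' z hz⟩

theorem add (h₁ : IsBoundedLimit D G g₁) (h₂ : IsBoundedLimit D G g₂) :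
    IsBoundedLimit D G fun z => g₁ z + g₂ z := by
  obtain ⟨⟨M₁, hM₁, hb₁⟩, ha₁⟩ := h₁
  obtain ⟨⟨M₂, hM₂, hb₂⟩, ha₂⟩ := h₂
  refine ⟨⟨M₁ + M₂, by positivity, fun z hz =>
    (norm_add_le _ _).trans (add_le_add (hb₁ z hz) (hb₂ z hz))⟩, fun ε hε => ?_⟩
  obtain ⟨r₁, hr₁, hr₁'⟩ := ha₁ (ε / 2) (half_pos hε)
  obtain ⟨r₂, hr₂, hr₂'⟩ := ha₂ (ε / 2) (half_pos hε)
  refine ⟨fun z => r₁ z + r₂ z, hr₁.add hr₂, fun z hz => ?_⟩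
  calc ‖g₁ z + g₂ z - (r₁ z + r₂ z)‖ = ‖(g₁ z - r₁ z) + (g₂ z - r₂ z)‖ := by congr 1; ring
    _ ≤ ε / 2 + ε / 2 := (norm_add_le _ _).trans (add_le_add (hr₁' z hz) (hr₂' z hz))
    _ = ε := add_halves ε

theorem mul (h₁ : IsBoundedLimit D G g₁) (h₂ : IsBoundedLimit D G g₂) :
    IsBoundedLimit D G fun z => g₁ z * g₂ z := by
  obtain ⟨⟨M₁, hM₁, hb₁⟩, ha₁⟩ := h₁
  obtain ⟨⟨M₂, hM₂, hb₂⟩, ha₂⟩ := h₂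
  refine ⟨⟨M₁ * M₂, by positivity, fun z hz => (norm_mul_le _ _).trans
    (mul_le_mul (hb₁ z hz) (hb₂ z hz) (norm_nonneg _) hM₁.le)⟩, fun ε hε => ?_⟩
  -- Tolerance at most 1 bounds `r₂` by `M₂ + 1`, which then fixes the tolerance for `r₁`.
  obtain ⟨r₂, hr₂, hr₂'⟩ := ha₂ (min 1 (ε / (2 * M₁))) (by positivity)
  obtain ⟨r₁, hr₁, hr₁'⟩ := ha₁ (ε / (2 * (M₂ + 1))) (by positivity)
  refine ⟨fun z => r₁ z * r₂ z, hr₁.mul hr₂, fun z hz => ?_⟩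
  have e₁ := hr₁' z hz
  have e₂ := (hr₂' z hz).trans (min_le_right _ _)
  have e₃ : ‖r₂ z‖ ≤ M₂ + 1 := by
    have := (hr₂' z hz).trans (min_le_left _ _)
    calc ‖r₂ z‖ = ‖g₂ z - (g₂ z - r₂ z)‖ := by congr 1; ring
      _ ≤ M₂ + 1 := (norm_sub_le _ _).trans (add_le_add (hb₂ z hz) this)
  calc ‖g₁ z * g₂ z - r₁ z * r₂ z‖ = ‖g₁ z * (g₂ z - r₂ z) + (g₁ z - r₁ z) * r₂ z‖ := by
        congr 1; ring
    _ ≤ ‖g₁ z‖ * ‖g₂ z - r₂ z‖ + ‖g₁ z - r₁ z‖ * ‖r₂ z‖ := by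
        rw [← norm_mul, ← norm_mul]; exact norm_add_le _ _
    _ ≤ M₁ * (ε / (2 * M₁)) + ε / (2 * (M₂ + 1)) * (M₂ + 1) := by
        gcongr
        exact hb₁ z hz
    _ = ε := by field_simp; ring

theorem pow (h : IsBoundedLimit D G g) (n : ℕ) : IsBoundedLimit D G fun z => g z ^ n := by
  induction n with
  | zero => simpa using const (D := D) (G := G) 1
  | succ n ih => simpa only [pow_succ] using ih.mul h

theorem sum {κ : Type*} {f : κ → ℂ → ℂ} (s : Finset κ) (h : ∀ i, IsBoundedLimit D G (f i)) :
    IsBoundedLimit D G fun z => ∑ i ∈ s, f i z := by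
  classical
  induction s using Finset.induction_on with
  | empty => simpa using const (D := D) (G := G) 0
  | insert i s hi ih => simpa only [Finset.sum_insert hi] using (h i).add ih

/-- The partial sums of the geometric series are holomorphic on all of `D`, even where `g = 1`; on
`G` the remainder g^N / (1 - g) is at most 2 · 2^(-N). -/
theorem inv_one_sub (hg : DifferentiableOn ℂ g D) (hG : ∀ z ∈ G, ‖g z‖ ≤ 1 / 2) :
    IsBoundedLimit D G fun z => (1 - g z)⁻¹ := by
  have hb : ∀ z ∈ G, ‖(1 - g z)⁻¹‖ ≤ 2 := by
    intro z hz
    have h1 : (1 : ℝ) / 2 ≤ ‖1 - g z‖ := by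
      have := norm_sub_norm_le (1 : ℂ) (g z)
      rw [norm_one] at this
      linarith [hG z hz]
    rw [norm_inv]
    exact inv_le_of_inv_le₀ (by norm_num) (by linarith)
  refine ⟨⟨2, two_pos, hb⟩, fun ε hε => ?_⟩
  obtain ⟨N, hN⟩ := exists_pow_lt_of_lt_one (half_pos hε) (by norm_num : (1 : ℝ) / 2 < 1)
  refine ⟨fun z => ∑ k ∈ Finset.range N, g z ^ k,
    DifferentiableOn.fun_sum fun k _ => hg.pow k, fun z hz => ?_⟩
  have hne : 1 - g z ≠ 0 := by
    intro h
    have h2 : g z = 1 := (sub_eq_zero.1 h).symm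
    have := hG z hz
    rw [h2, norm_one] at this
    norm_num at this
  have : (1 - g z)⁻¹ - ∑ k ∈ Finset.range N, g z ^ k = g z ^ N * (1 - g z)⁻¹ := by
    have h := mul_neg_geom_sum (g z) N
    field_simp
    linear_combination -h
  rw [this, norm_mul, norm_pow]
  calc ‖g z‖ ^ N * ‖(1 - g z)⁻¹‖ ≤ (1 / 2) ^ N * 2 := by
        gcongr
        · exact hG z hz
        · exact hb z hz
    _ ≤ ε := by linarith

end IsBoundedLimit

/-- For `a` in an open set `D`, the function `1 / (z - a)` is a uniform limit of functions
holomorphic on `D` on a bounded set `G a` that contains any given compact subset of `D`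
once `a` is close to the boundary of `D` (or to infinity). -/
theorem exists_approximation_sets {D : Set ℂ} (hD : IsOpen D) :
    ∃ G : ℂ → Set ℂ,
      (∀ a ∈ D, Bornology.IsBounded (G a) ∧ IsBoundedLimit D (G a) fun z => (z - a)⁻¹) ∧
      ∀ K ⊆ D, IsCompact K → ∃ K' ⊆ D, IsCompact K' ∧ ∀ a ∈ D, a ∉ K' → K ⊆ G a := by
  -- Expansion at the origin: 1 / (z - a) = -a⁻¹ / (1 - z / a).
  have hfar : ∀ a : ℂ, IsBoundedLimit D (ball 0 (‖a‖ / 2)) fun z => (z - a)⁻¹ := by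
    intro a
    rcases eq_or_ne a 0 with rfl | ha
    · have : ball (0 : ℂ) (‖(0 : ℂ)‖ / 2) = ∅ := by simp
      rw [this]
      exact ⟨⟨1, one_pos, by simp⟩, fun ε _ => ⟨0, differentiableOn_const 0, by simp⟩⟩
    have h := (IsBoundedLimit.const (D := D) (G := ball 0 (‖a‖ / 2)) (-a⁻¹)).mul
      (IsBoundedLimit.inv_one_sub (D := D) (G := ball 0 (‖a‖ / 2)) (g := fun z => z / a)
        (by fun_prop) ?_)
    · refine h.congr fun z _ => ?_
      have : z - a = -(a * (1 - z / a)) := by field_simp; ring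
      rw [this, inv_neg, mul_inv, neg_mul]
    · intro z hz
      rw [mem_ball_zero_iff] at hz
      have : 0 < ‖a‖ := norm_pos_iff.2 ha
      rw [norm_div, div_le_iff₀ this]
      linarith
  rcases (Dᶜ).eq_empty_or_nonempty with hDc | hDc
  · have hDu : D = univ := compl_empty_iff.1 hDc
    refine ⟨fun a => ball 0 (‖a‖ / 2), fun a _ => ⟨isBounded_ball, hfar a⟩, fun K _ hK => ?_⟩
    obtain ⟨M, hM⟩ := hK.isBounded.exists_norm_le
    refine ⟨closedBall 0 (2 * M), by simp [hDu], isCompact_closedBall _ _, fun a _ ha z hz => ?_⟩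
    rw [mem_closedBall_zero_iff, not_le] at ha
    rw [mem_ball_zero_iff]
    linarith [hM z hz]
  have hcl : IsClosed Dᶜ := hD.isClosed_compl
  have hpos : ∀ a ∈ D, 0 < infDist a Dᶜ := fun a ha =>
    (hcl.notMem_iff_infDist_pos hDc).1 (by simpa using ha)
  choose w hwD hw using fun a : ℂ => hcl.exists_infDist_eq_dist hDc a
  classical
  -- Let d be the distance from `a` to the complement and `w a` a nearest point there. If ‖a‖ d < 1,
  -- expand around `w a`: |z - w a| ≥ 2d makes the ratio (a - w a) / (z - w a) at most 1/2. The ball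
  -- of radius d⁻¹ keeps the set bounded. Otherwise expand around 0.
  refine ⟨fun a => if ‖a‖ * infDist a Dᶜ < 1 then
    closedBall 0 (infDist a Dᶜ)⁻¹ ∩ {z | 2 * infDist a Dᶜ ≤ ‖z - w a‖} else ball 0 (‖a‖ / 2),
    fun a ha => ?_, fun K hKD hK => ?_⟩
  · dsimp only
    split_ifs
    · refine ⟨isBounded_closedBall.subset inter_subset_left, ?_⟩
      have hd := hpos a ha
      set d := infDist a Dᶜ with hd_def
      have hwa : ‖a - w a‖ = d := by rw [← dist_eq_norm, ← hw a]
      have hne : ∀ z ∈ D, z - w a ≠ 0 := fun z hz h => hwD a (sub_eq_zero.1 h ▸ hz)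
      set G := closedBall (0 : ℂ) d⁻¹ ∩ {z | 2 * d ≤ ‖z - w a‖} with hG
      have hge : ∀ z ∈ G, 2 * d ≤ ‖z - w a‖ := fun z hz => hz.2
      have h₁ : IsBoundedLimit D G fun z => (z - w a)⁻¹ := by
        refine IsBoundedLimit.of_differentiableOn (M := (2 * d)⁻¹) ?_ fun z hz => ?_
        · exact DifferentiableOn.inv (by fun_prop) hne
        · rw [norm_inv]
          exact inv_anti₀ (by positivity) (hge z hz)
      have h₂ : IsBoundedLimit D G fun z => (1 - (a - w a) / (z - w a))⁻¹ := by
        refine IsBoundedLimit.inv_one_sub ?_ fun z hz => ?_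
        · exact DifferentiableOn.div (by fun_prop) (by fun_prop) hne
        · have := hge z hz
          rw [norm_div, hwa, div_le_iff₀ (by linarith)]
          linarith
      refine (h₁.mul h₂).congr fun z hz => ?_
      have hz0 : z - w a ≠ 0 := by
        rw [← norm_pos_iff]
        linarith [hge z hz]
      rw [← mul_inv, mul_sub, mul_div_cancel₀ _ hz0]
      congr 1
      ring
    · exact ⟨isBounded_ball, hfar a⟩
  · obtain ⟨M, hM0, hM⟩ := hK.isBounded.exists_pos_norm_le
    obtain ⟨δ, hδ0, hδ⟩ : ∃ δ > 0, ∀ z ∈ K, δ ≤ infDist z Dᶜ := by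
      rcases K.eq_empty_or_nonempty with rfl | hKne
      · exact ⟨1, one_pos, by simp⟩
      obtain ⟨z₀, hz₀, hmin⟩ := hK.exists_isMinOn hKne (continuous_infDist_pt Dᶜ).continuousOn
      exact ⟨_, hpos z₀ (hKD hz₀), fun z hz => hmin hz⟩
    -- For `a` outside the compact set below, ‖a‖ d < 1 forces d < c, hence d⁻¹ > M and 2d < δ;
    -- while ‖a‖ d ≥ 1 forces ‖a‖ > 2M. In both cases `K` lies in the approximation set.
    let c := min (1 / (2 * M)) (δ / 2)
    have hc : 0 < c := by positivity
    refine ⟨closedBall 0 (max (1 / c) (2 * M)) ∩ {z | c ≤ infDist z Dᶜ}, ?_, ?_, ?_⟩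
    · rintro z ⟨-, hz⟩
      by_contra h
      have : infDist z Dᶜ = 0 := infDist_zero_of_mem h
      rw [mem_ofPred_eq, this] at hz
      linarith
    · exact (isCompact_closedBall _ _).inter_right
        (isClosed_le continuous_const (continuous_infDist_pt _))
    · intro a ha haK z hz
      have hd := hpos a ha
      have hc1 : c ≤ 1 / (2 * M) := min_le_left _ _
      have hc2 : c ≤ δ / 2 := min_le_right _ _
      have hzM := hM z hz
      dsimp only
      split_ifs with hcase
      · have hdc : infDist a Dᶜ < c := by
          by_contra h
          push Not at h
          refine haK ⟨?_, h⟩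
          rw [mem_closedBall_zero_iff]
          refine le_trans ?_ (le_max_left _ _)
          rw [le_div_iff₀ hc]
          nlinarith [norm_nonneg a]
        refine ⟨?_, ?_⟩
        · rw [mem_closedBall_zero_iff]
          refine hzM.trans ?_
          rw [le_inv_comm₀ hM0 hd]
          have : 1 / (2 * M) ≤ M⁻¹ := by
            rw [one_div]; exact inv_anti₀ hM0 (by linarith)
          linarith
        · have h1 := infDist_le_dist_of_mem (x := z) (hwD a)
          rw [dist_eq_norm] at h1
          have h2 := hδ z hz
          rw [mem_ofPred_eq]
          linarith
      · push Not at hcase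
        rw [mem_ball_zero_iff]
        by_contra h
        push Not at h
        have haM : ‖a‖ ≤ 2 * M := by linarith
        refine haK ⟨?_, ?_⟩
        · rw [mem_closedBall_zero_iff]
          exact haM.trans (le_max_right _ _)
        · refine hc1.trans ?_
          rw [div_le_iff₀ (by positivity)]
          nlinarith

/-! ### The Mittag-Leffler theorem with real principal parts -/

/-- The real quadratic polynomial with roots `x ± iy`. -/
def quad (x y : ℝ) (z : ℂ) : ℂ := (z - x) ^ 2 + (y : ℂ) ^ 2

theorem quad_eq_mul (x y : ℝ) (z : ℂ) : quad x y z = (z - ⟨x, y⟩) * (z - ⟨x, -y⟩) := by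
  have h : ∀ t : ℝ, (⟨x, t⟩ : ℂ) = x + t * Complex.I := fun t => Complex.mk_eq_add_mul_I x t
  rw [quad, h, h]
  push_cast
  linear_combination (y ^ 2 : ℂ) * Complex.I_sq

theorem quad_eq_zero_iff {x y : ℝ} {z : ℂ} : quad x y z = 0 ↔ z = ⟨x, y⟩ ∨ z = ⟨x, -y⟩ := by
  rw [quad_eq_mul, mul_eq_zero, sub_eq_zero, sub_eq_zero]

@[simp] theorem quad_conj (x y : ℝ) (z : ℂ) : quad x y (conj z) = conj (quad x y z) := by
  simp [quad]

theorem differentiable_quad (x y : ℝ) : Differentiable ℂ (quad x y) := by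
  unfold quad; fun_prop

theorem continuous_quad (x y : ℝ) : Continuous (quad x y) := (differentiable_quad x y).continuous

/-- The principal part `∑ ((z - x)² + y²)^(-n) (cₙ + (z - x) dₙ)`, `1 ≤ n ≤ m`, with real
coefficients. -/
noncomputable def polePart (x y : ℝ) (m : ℕ) (c d : ℕ → ℝ) (z : ℂ) : ℂ :=
  ∑ n ∈ Finset.Icc 1 m, quad x y z ^ (-(n : ℤ)) * (c n + (z - x) * d n)

theorem polePart_conj (x y : ℝ) (m : ℕ) (c d : ℕ → ℝ) (z : ℂ) :
    polePart x y m c d (conj z) = conj (polePart x y m c d z) := by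
  simp [polePart]

theorem differentiableOn_polePart (x y : ℝ) (m : ℕ) (c d : ℕ → ℝ) :
    DifferentiableOn ℂ (polePart x y m c d) {z | quad x y z ≠ 0} := by
  unfold polePart
  refine DifferentiableOn.fun_sum fun n _ => DifferentiableOn.mul ?_ (by fun_prop)
  exact (differentiable_quad x y).differentiableOn.zpow (Or.inl fun z hz => hz)

/-- A sum of functions which are holomorphic on an open set `U` and bounded by the terms of a
convergent series on every compact subset of `D ⊇ U`, up to finitely many terms, is holomorphic. -/
theorem differentiableOn_tsum_of_cofinite {ι : Type*} {D U : Set ℂ} (hU : IsOpen U) (hUD : U ⊆ D)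
    {f : ι → ℂ → ℂ} (hf : ∀ i, DifferentiableOn ℂ (f i) U) {u : ι → ℝ} (hu : Summable u)
    (hb : ∀ K ⊆ D, IsCompact K → ∀ᶠ i in cofinite, ∀ z ∈ K, ‖f i z‖ ≤ u i) :
    DifferentiableOn ℂ (fun z => ∑' i, f i z) U := by
  have h : TendstoLocallyUniformlyOn (fun (t : Finset ι) z => ∑ i ∈ t, f i z)
      (fun z => ∑' i, f i z) atTop U := by
    rw [tendstoLocallyUniformlyOn_iff_forall_isCompact hU]
    intro K hKU hK
    exact tendstoUniformlyOn_tsum_of_cofinite_eventually hu (hb K (hKU.trans hUD) hK)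
  exact h.differentiableOn
    (Eventually.of_forall fun t => DifferentiableOn.fun_sum fun i _ => hf i) hU

/-- The symmetrization `z ↦ (g z + conj (g (conj z))) / 2` of a complex function. -/
noncomputable def symmetrize (g : ℂ → ℂ) (z : ℂ) : ℂ := (g z + conj (g (conj z))) / 2

theorem symmetrize_conj (g : ℂ → ℂ) (z : ℂ) :
    symmetrize g (conj z) = conj (symmetrize g z) := by
  simp [symmetrize, add_comm, Complex.conj_ofNat]

theorem differentiableOn_symmetrize {U : Set ℂ} (hU : IsOpen U) (hsymm : ∀ z ∈ U, conj z ∈ U)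
    {g : ℂ → ℂ} (hg : DifferentiableOn ℂ g U) : DifferentiableOn ℂ (symmetrize g) U := by
  intro z hz
  have h₁ := hg.differentiableAt (hU.mem_nhds hz)
  have h₂ := hg.differentiableAt (hU.mem_nhds (hsymm z hz))
  have h₃ : DifferentiableAt ℂ (fun z => conj (g (conj z))) z := by
    simpa [Function.comp_def] using h₂.conj_conj
  exact ((h₁.add h₃).div_const 2).differentiableWithinAt

theorem isSigmaCompact_of_isOpen {D : Set ℂ} (hD : IsOpen D) : IsSigmaCompact D := by
  have := hD.locallyCompactSpace
  exact isSigmaCompact_iff_sigmaCompactSpace.2 inferInstance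

section MittagLeffler

variable {ι : Type*} {D : Set ℂ} {x y : ι → ℝ}

/-- The zeros of the polynomials `(z - x α)² + (y α)²` with `α ∈ s`. -/
def zeros (x y : ι → ℝ) (s : Set ι) : Set ℂ := {z | ∃ α ∈ s, quad (x α) (y α) z = 0}

theorem conj_mem_zeros {s : Set ι} {z : ℂ} (hz : conj z ∈ zeros x y s) : z ∈ zeros x y s := by
  obtain ⟨α, hα, h⟩ := hz
  exact ⟨α, hα, by simpa using h⟩

/-- The zeros are locally finite: only finitely many polynomials vanish somewhere on a small closed
disc in `D`, and those with index in `s` are nonzero near its centre. -/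
theorem isOpen_diff_zeros (hD : IsOpen D)
    (hfin : ∀ K ⊆ D, IsCompact K → {α | ∃ z ∈ K, quad (x α) (y α) z = 0}.Finite) (s : Set ι) :
    IsOpen (D \ zeros x y s) := by
  rw [isOpen_iff_mem_nhds]
  rintro z ⟨hz, hzs⟩
  obtain ⟨r, hr, hrD⟩ := nhds_basis_closedBall.mem_iff.1 (hD.mem_nhds hz)
  have hF := hfin _ hrD (isCompact_closedBall z r)
  have hev : ∀ᶠ w in 𝓝 z, ∀ α ∈ {α | ∃ z' ∈ closedBall z r, quad (x α) (y α) z' = 0},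
      α ∈ s → quad (x α) (y α) w ≠ 0 := by
    rw [eventually_all_finite hF]
    intro α _
    by_cases hα : α ∈ s
    · have : quad (x α) (y α) z ≠ 0 := fun h => hzs ⟨α, hα, h⟩
      filter_upwards [(continuous_quad (x α) (y α)).continuousAt.eventually_ne this] with w hw _
        using hw
    · exact Eventually.of_forall fun w h => absurd h hα
  filter_upwards [hev, closedBall_mem_nhds z hr] with w hw hwr
  exact ⟨hrD hwr, fun ⟨α, hα, h0⟩ => hw α ⟨w, hwr, h0⟩ hα h0⟩

/-- `D` is σ-compact, and each compact piece accounts for finitely many indices. -/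
theorem countable_index (hD : IsOpen D) (hmem : ∀ α z, quad (x α) (y α) z = 0 → z ∈ D)
    (hfin : ∀ K ⊆ D, IsCompact K → {α | ∃ z ∈ K, quad (x α) (y α) z = 0}.Finite) :
    Countable ι := by
  obtain ⟨K, hK, hKD⟩ := isSigmaCompact_of_isOpen hD
  rw [← countable_univ_iff]
  refine (countable_iUnion fun n => (hfin (K n) (hKD ▸ subset_iUnion K n) (hK n)).countable).mono
    fun α _ => ?_
  have h0 : quad (x α) (y α) ⟨x α, y α⟩ = 0 := quad_eq_zero_iff.2 (Or.inl rfl)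
  have := hmem α _ h0
  rw [← hKD] at this
  obtain ⟨n, hn⟩ := mem_iUnion.1 this
  exact mem_iUnion.2 ⟨n, _, hn, h0⟩

theorem countable_zeros [Countable ι] (s : Set ι) : (zeros x y s).Countable := by
  refine (countable_iUnion fun α : ι =>
    ((countable_singleton (⟨x α, -y α⟩ : ℂ)).insert ⟨x α, y α⟩)).mono ?_
  rintro z ⟨α, -, h⟩
  exact mem_iUnion.2 ⟨α, quad_eq_zero_iff.1 h⟩

/-- The reciprocal of the quadratic is a product of two simple poles, and bounded limits form an
algebra, containing the coordinate `z` because `G` is bounded. -/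
theorem isBoundedLimit_polePart {G : Set ℂ} (hG : Bornology.IsBounded G) {a b : ℝ}
    (h₁ : IsBoundedLimit D G fun z => (z - ⟨a, b⟩)⁻¹)
    (h₂ : IsBoundedLimit D G fun z => (z - ⟨a, -b⟩)⁻¹) (m : ℕ) (c d : ℕ → ℝ) :
    IsBoundedLimit D G (polePart a b m c d) := by
  obtain ⟨M, hM⟩ := hG.exists_norm_le
  have hid : IsBoundedLimit D G fun z => z :=
    IsBoundedLimit.of_differentiableOn differentiableOn_id hM
  refine (IsBoundedLimit.sum (Finset.Icc 1 m) fun n => ((h₁.mul h₂).pow n).mul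
    ((IsBoundedLimit.const (c n : ℂ)).add
      ((hid.add (IsBoundedLimit.const (-a : ℂ))).mul (IsBoundedLimit.const (d n : ℂ))))).congr
    fun z _ => ?_
  simp only [polePart, quad_eq_mul, zpow_neg, zpow_natCast, ← mul_inv, inv_pow, ← sub_eq_add_neg]

/-- The Mittag-Leffler theorem on an open set `D` symmetric about the real axis, with prescribed
real principal parts at pairs of conjugate points. -/
theorem exists_mittagLeffler (hD : IsOpen D) (hsymm : ∀ z ∈ D, conj z ∈ D)
    (hmem : ∀ α z, quad (x α) (y α) z = 0 → z ∈ D)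
    (hfin : ∀ K ⊆ D, IsCompact K → {α | ∃ z ∈ K, quad (x α) (y α) z = 0}.Finite)
    (m : ι → ℕ) (c d : ι → ℕ → ℝ) :
    ∃ h : ℂ → ℂ, (∀ z, h (conj z) = conj (h z)) ∧ DifferentiableOn ℂ h (D \ zeros x y univ) ∧
      ∀ α, ∃ g : ℂ → ℂ, (∀ z, g (conj z) = conj (g z)) ∧
        DifferentiableOn ℂ g (D \ zeros x y {α}ᶜ) ∧
        ∀ z ∈ D \ zeros x y univ, h z = polePart (x α) (y α) (m α) (c α) (d α) z + g z := by
  classical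
  have := countable_index hD hmem hfin
  obtain ⟨u, hu0, b, hus, -⟩ := NNReal.exists_pos_sum_of_countable one_ne_zero ι
  have hu : Summable fun α => (u α : ℝ) := NNReal.summable_coe.2 hus.summable
  obtain ⟨G, hG, hGK⟩ := exists_approximation_sets hD
  let p : ι → ℂ → ℂ := fun α => polePart (x α) (y α) (m α) (c α) (d α)
  let S : ι → Set ℂ := fun α => G ⟨x α, y α⟩ ∩ G ⟨x α, -y α⟩
  have hz₁ : ∀ α, quad (x α) (y α) ⟨x α, y α⟩ = 0 := fun α => quad_eq_zero_iff.2 (Or.inl rfl)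
  have hz₂ : ∀ α, quad (x α) (y α) ⟨x α, -y α⟩ = 0 := fun α => quad_eq_zero_iff.2 (Or.inr rfl)
  have happ : ∀ α, ∃ r : ℂ → ℂ, DifferentiableOn ℂ r D ∧ ∀ z ∈ S α, ‖p α z - r z‖ ≤ u α := by
    intro α
    obtain ⟨hB, h₁⟩ := hG _ (hmem α _ (hz₁ α))
    obtain ⟨-, h₂⟩ := hG _ (hmem α _ (hz₂ α))
    exact (isBoundedLimit_polePart (hB.subset inter_subset_left) (h₁.mono inter_subset_left)
      (h₂.mono inter_subset_right) (m α) (c α) (d α)).approx _ (NNReal.coe_pos.2 (hu0 α))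
  choose r hr hrS using happ
  -- For all but finitely many α both roots lie outside `K'`, so `K ⊆ S α`.
  have hb : ∀ K ⊆ D, IsCompact K → ∀ᶠ α in cofinite, ∀ z ∈ K, ‖p α z - r α z‖ ≤ u α := by
    intro K hKD hK
    obtain ⟨K', hK'D, hK', hKG⟩ := hGK K hKD hK
    refine (hfin K' hK'D hK').subset fun α hα => ?_
    by_contra hcon
    refine hα fun z hz => hrS α z ⟨?_, ?_⟩
    · exact hKG _ (hmem α _ (hz₁ α)) (fun h => hcon ⟨_, h, hz₁ α⟩) hz
    · exact hKG _ (hmem α _ (hz₂ α)) (fun h => hcon ⟨_, h, hz₂ α⟩) hz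
  have hopen := isOpen_diff_zeros hD hfin
  have hp : ∀ α s, α ∈ s → DifferentiableOn ℂ (p α) (D \ zeros x y s) := fun α s hα =>
    (differentiableOn_polePart _ _ _ _ _).mono fun z hz h0 => hz.2 ⟨α, hα, h0⟩
  have hsymm' : ∀ s, ∀ z ∈ D \ zeros x y s, conj z ∈ D \ zeros x y s := fun s z hz =>
    ⟨hsymm z hz.1, fun h => hz.2 (conj_mem_zeros h)⟩
  let f : ι → ℂ → ℂ := fun α z => p α z - r α z
  -- The same series with the α-th principal part deleted: its sum is holomorphic across the α-th
  -- roots.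
  let f' : ι → ι → ℂ → ℂ := fun α β => if β = α then fun z => -r α z else f β
  refine ⟨symmetrize fun z => ∑' α, f α z, symmetrize_conj _,
    differentiableOn_symmetrize (hopen _) (hsymm' _) ?_, fun α =>
    ⟨symmetrize fun z => ∑' β, f' α β z, symmetrize_conj _,
      differentiableOn_symmetrize (hopen _) (hsymm' _) ?_, ?_⟩⟩
  · exact differentiableOn_tsum_of_cofinite (hopen _) sdiff_subset
      (fun α => (hp α _ (mem_univ α)).sub ((hr α).mono sdiff_subset)) hu hb
  · refine differentiableOn_tsum_of_cofinite (hopen _) sdiff_subset (fun β => ?_) hu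
      fun K hKD hK => ?_
    · by_cases hβ : β = α
      · rw [show f' α β = fun z => -r α z from if_pos hβ]
        exact ((hr α).mono sdiff_subset).neg
      · rw [show f' α β = f β from if_neg hβ]
        exact (hp β _ hβ).sub ((hr β).mono sdiff_subset)
    · have hα : ∀ᶠ β in cofinite, β ≠ α := by simp
      filter_upwards [hb K hKD hK, hα] with β hβ hne z hz
      simpa only [f', hne, if_false] using hβ z hz
  · have key : ∀ z ∈ D \ zeros x y univ, ∑' β, f β z = p α z + ∑' β, f' α β z := by
      intro z hz
      have hs : Summable fun β => f β z := by
        refine Summable.of_norm_bounded_eventually hu ?_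
        filter_upwards [hb {z} (singleton_subset_iff.2 hz.1) isCompact_singleton] with β hβ
          using hβ z rfl
      have h₁ : HasSum (fun β => if β = α then p α z else 0) (p α z) := hasSum_ite_eq α (p α z)
      have h₂ := hs.hasSum.sub h₁
      have h₃ : (fun β => f β z - if β = α then p α z else 0) = fun β => f' α β z := by
        funext β
        by_cases hβ : β = α
        · subst hβ; simp [f', f]
        · simp [f', hβ]
      rw [h₃] at h₂
      rw [h₂.tsum_eq]
      ring
    intro z hz
    -- Real coefficients: symmetrization does not change the principal part.
    have hpz : conj (p α (conj z)) = p α z := by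
      rw [show p α (conj z) = conj (p α z) from polePart_conj _ _ _ _ _ _, Complex.conj_conj]
    simp only [symmetrize]
    rw [key z hz, key _ (hsymm' _ z hz), map_add, hpz]
    ring

end MittagLeffler

/-! ### Spherical and Laurent expansions in one complex variable -/

theorem hasSum_of_eq {E β : Type*} [AddCommMonoid E] [TopologicalSpace E] {f g : β → E} {a b : E}
    (h : HasSum f a) (hfg : ∀ i, g i = f i) (hab : b = a) : HasSum g b := by
  rwa [hab, funext hfg]

theorem exists_hasSum_pow {f : ℂ → ℂ} {a : ℂ} (hf : AnalyticAt ℂ f a) :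
    ∃ (c : ℕ → ℂ) (r : ℝ), 0 < r ∧ ∀ z, ‖z - a‖ < r → HasSum (fun n => (z - a) ^ n * c n) (f z) := by
  obtain ⟨p, hp⟩ := hf
  obtain ⟨r, hr, h⟩ := Metric.eventually_nhds_iff_ball.1 (hasFPowerSeriesAt_iff.1 hp)
  refine ⟨p.coeff, r, hr, fun z hz => ?_⟩
  simpa using h (z - a) (by simpa using hz)

/-- An analytic function at `x` is the sum of a series `∑ (z - x)^(2j) (cⱼ + (z - x) dⱼ)`. -/
theorem exists_hasSum_quad_of_real {H : ℂ → ℂ} {x : ℝ} (hH : AnalyticAt ℂ H x) :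
    ∃ (c d : ℕ → ℂ) (R : ℝ), 0 < R ∧ ∀ z, ‖quad x 0 z‖ < R →
      HasSum (fun j => quad x 0 z ^ j * (c j + (z - x) * d j)) (H z) := by
  obtain ⟨c, r, hr, h⟩ := exists_hasSum_pow hH
  refine ⟨fun j => c (2 * j), fun j => c (2 * j + 1), r ^ 2, by positivity, fun z hz => ?_⟩
  have hz' : ‖z - x‖ < r := by
    rw [quad] at hz
    simp only [Complex.ofReal_zero, ne_eq, OfNat.ofNat_ne_zero, not_false_eq_true, zero_pow,
      add_zero, norm_pow] at hz
    exact lt_of_pow_lt_pow_left₀ 2 hr.le hz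
  have hs := h z hz'
  -- Group the Taylor series in pairs of even and odd degree.
  have h₁ : HasSum (fun p : ℕ × Fin 2 => (z - x) ^ (p.1 * 2 + p.2) * c (p.1 * 2 + p.2)) (H z) := by
    have := (Nat.divModEquiv 2).symm.hasSum_iff.2 hs
    simpa [Function.comp_def] using this
  have h₂ := h₁.prod_fiberwise fun j => hasSum_fintype _
  convert h₂ using 2 with j
  simp only [Fin.sum_univ_two, quad]
  simp only [Fin.val_zero, Fin.val_one, mul_comm j 2, Complex.ofReal_zero, ne_eq,
    OfNat.ofNat_ne_zero, not_false_eq_true, zero_pow, add_zero, pow_succ _ (2 * j), pow_mul]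
  ring

/-- A function which is analytic at `x ± iy`, `y ≠ 0`, is the sum of a series
`∑ ((z - x)² + y²)^j (cⱼ + (z - x) dⱼ)`. -/
theorem exists_hasSum_quad_of_ne_zero {H : ℂ → ℂ} {x y : ℝ} (hy : y ≠ 0)
    (h₁ : AnalyticAt ℂ H ⟨x, y⟩) (h₂ : AnalyticAt ℂ H ⟨x, -y⟩) :
    ∃ (c d : ℕ → ℂ) (R : ℝ), 0 < R ∧ ∀ z, ‖quad x y z‖ < R →
      HasSum (fun j => quad x y z ^ j * (c j + (z - x) * d j)) (H z) := by
  -- A branch of √(w - y²) near w = 0 with s(0) = iy; the solutions of quad = w are then x ± s(w).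
  let s : ℂ → ℂ := fun w => y * Complex.I * Complex.exp (Complex.log (1 - w / y ^ 2) / 2)
  have hyC : (y : ℂ) ≠ 0 := by exact_mod_cast hy
  have hs0 : s 0 = y * Complex.I := by simp [s]
  have hsa : AnalyticAt ℂ s 0 := by
    have : AnalyticAt ℂ (fun w : ℂ => Complex.log (1 - w / y ^ 2)) 0 :=
      AnalyticAt.clog (by fun_prop (disch := simp [hy])) (by simp)
    exact analyticAt_const.mul (this.div_const.cexp)
  have hsne : ∀ w, s w ≠ 0 := fun w => by simp [s, hy]
  have hev : ∀ᶠ w in 𝓝 (0 : ℂ), s w ^ 2 = w - y ^ 2 := by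
    have hc : ContinuousAt (fun w : ℂ => 1 - w / y ^ 2) 0 := by fun_prop
    filter_upwards [hc.eventually_ne (by simp : (1 : ℂ) - 0 / y ^ 2 ≠ 0)] with w hw
    simp only [s, mul_pow, Complex.I_sq]
    rw [← Complex.exp_nat_mul]
    have : ((2 : ℕ) : ℂ) * (Complex.log (1 - w / y ^ 2) / 2) = Complex.log (1 - w / y ^ 2) := by
      push_cast; ring
    rw [this, Complex.exp_log hw]
    field_simp
    ring
  have hz₁ : (⟨x, y⟩ : ℂ) = x + s 0 := by rw [hs0, Complex.mk_eq_add_mul_I]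
  have hz₂ : (⟨x, -y⟩ : ℂ) = x - s 0 := by
    rw [hs0, Complex.mk_eq_add_mul_I]; push_cast; ring
  have hp : AnalyticAt ℂ (fun w => H (x + s w)) 0 :=
    AnalyticAt.fun_comp (by rwa [← hz₁]) (analyticAt_const.add hsa)
  have hm : AnalyticAt ℂ (fun w => H (x - s w)) 0 :=
    AnalyticAt.fun_comp (by rwa [← hz₂]) (analyticAt_const.sub hsa)
  -- The even part (H(x+s) + H(x-s))/2 and the divided odd part (H(x+s) - H(x-s))/(2s) are analytic
  -- in w; even + (z - x) · odd recovers `H` at both roots.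
  obtain ⟨c, r₁, hr₁, hc⟩ := exists_hasSum_pow ((hp.add hm).div_const (c := 2))
  obtain ⟨d, r₂, hr₂, hd⟩ := exists_hasSum_pow
    ((hp.sub hm).div (analyticAt_const (v := (2 : ℂ)) |>.mul hsa) (by simp [hsne]))
  obtain ⟨r₃, hr₃, hs⟩ := Metric.eventually_nhds_iff_ball.1 hev
  refine ⟨c, d, min r₁ (min r₂ r₃), by positivity, fun z hz => ?_⟩
  obtain ⟨hz1, hz2, hz3⟩ : ‖quad x y z‖ < r₁ ∧ ‖quad x y z‖ < r₂ ∧ ‖quad x y z‖ < r₃ := by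
    simpa [lt_min_iff] using hz
  have hc' := hc _ (by simpa using hz1)
  have hd' := hd _ (by simpa using hz2)
  have hs' := hs _ (by simpa using hz3)
  have hroot : z - x = s (quad x y z) ∨ z - x = -s (quad x y z) := by
    apply sq_eq_sq_iff_eq_or_eq_neg.1
    rw [hs', quad]
    ring
  have h2s : s (quad x y z) ≠ 0 := hsne _
  have := hc'.add (hd'.mul_left (z - x))
  convert this using 1
  · funext j
    rw [sub_zero]
    ring
  · simp only [Pi.add_apply, Pi.sub_apply, Pi.mul_apply, Pi.div_apply]
    rcases hroot with h | h
    · have hz : z = x + s (quad x y z) := by rw [← h]; ring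
      rw [h, ← hz]
      field_simp
      ring
    · have hz : z = x - s (quad x y z) := by rw [← neg_eq_iff_eq_neg.2 h]; ring
      rw [h, ← hz]
      field_simp
      ring

/-- The spherical expansion, with real coefficients, of a function which is analytic at `x ± iy`
and commutes with complex conjugation. -/
theorem exists_hasSum_quad {H : ℂ → ℂ} {x y : ℝ} (hconj : ∀ z, H (conj z) = conj (H z))
    (h₁ : AnalyticAt ℂ H ⟨x, y⟩) (h₂ : AnalyticAt ℂ H ⟨x, -y⟩) :
    ∃ (c d : ℕ → ℝ) (R : ℝ), 0 < R ∧ ∀ z, ‖quad x y z‖ < R →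
      HasSum (fun j => quad x y z ^ j * (c j + (z - x) * d j)) (H z) := by
  obtain ⟨c, d, R, hR, h⟩ : ∃ (c d : ℕ → ℂ) (R : ℝ), 0 < R ∧ ∀ z, ‖quad x y z‖ < R →
      HasSum (fun j => quad x y z ^ j * (c j + (z - x) * d j)) (H z) := by
    rcases eq_or_ne y 0 with rfl | hy
    · exact exists_hasSum_quad_of_real h₁
    · exact exists_hasSum_quad_of_ne_zero hy h₁ h₂
  -- Averaging the expansion at `z` with the conjugate of the one at `conj z` replaces coefficients
  -- by their real parts and leaves the sum `H z`.
  refine ⟨fun j => (c j).re, fun j => (d j).re, R, hR, fun z hz => ?_⟩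
  have hz' := h (conj z) (by rw [quad_conj, Complex.norm_conj]; exact hz)
  have hz'' := (Complex.hasSum_conj'.2 hz')
  have := ((h z hz).add hz'').mul_left (1 / 2)
  refine hasSum_of_eq this (fun j => ?_) ?_
  · simp only [Complex.re_eq_add_conj, map_mul, map_pow, map_add, map_sub, quad_conj,
      Complex.conj_conj, Complex.conj_ofReal]
    ring
  · rw [hconj, Complex.conj_conj]
    ring

/-- The product of a finite principal part and an analytic function has a Laurent expansion
with finitely many terms of negative degree. -/
theorem exists_hasSum_zpow {f : ℂ → ℂ} {a : ℂ} {m : ℕ}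
    (hf : ∃ G : ℂ → ℂ, AnalyticAt ℂ G a ∧ ∀ᶠ z in 𝓝[≠] a, f z = (z - a) ^ (-(m : ℤ)) * G z) :
    ∃ (c : ℤ → ℂ) (r : ℝ), 0 < r ∧ (∀ k : ℕ, m < k → c (-(k : ℤ)) = 0) ∧
      ∀ z, 0 < ‖z - a‖ → ‖z - a‖ < r → HasSum (fun n => (z - a) ^ n * c n) (f z) := by
  obtain ⟨G, hG, hfG⟩ := hf
  obtain ⟨c, r₁, hr₁, hc⟩ := exists_hasSum_pow hG
  obtain ⟨r₂, hr₂, h₂⟩ := Metric.eventually_nhds_iff_ball.1 (eventually_nhdsWithin_iff.1 hfG)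
  let i : ℕ → ℤ := fun n => (n : ℤ) - m
  have hi : Function.Injective i := fun a b h => by simpa [i] using h
  refine ⟨fun n => if 0 ≤ n + m then c (n + m).toNat else 0, min r₁ r₂, by positivity,
    fun k hk => if_neg (by omega), fun z hz0 hz => ?_⟩
  have hne : z - a ≠ 0 := norm_pos_iff.1 hz0
  rw [h₂ z (by simpa [dist_eq_norm] using hz.trans_le (min_le_right _ _)) (sub_ne_zero.1 hne)]
  rw [← hi.hasSum_iff]
  · refine hasSum_of_eq ((hc z (hz.trans_le (min_le_left _ _))).mul_left ((z - a) ^ (-(m : ℤ))))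
      (fun n => ?_) rfl
    have h1 : i n + m = n := by simp [i]
    simp only [Function.comp_apply, h1, Int.toNat_natCast, Int.natCast_nonneg, if_true]
    rw [← mul_assoc]
    congr 1
    rw [← zpow_natCast, ← zpow_add₀ hne]
    congr 1
    simp only [i]
    ring
  · intro n hn
    have : ¬ 0 ≤ n + m := fun h => hn ⟨(n + m).toNat, by simp [i, h]⟩
    simp [this]

/-! ### Slices of the quaternions and extension of complex functions -/

/-- The parametrization `x + iy ↦ x + Iy` of the plane `ℝ + Iℝ`. -/
noncomputable def sliceMap (I : ℍ[ℝ]) (z : ℂ) : ℍ[ℝ] := (z.re : ℍ[ℝ]) + I * (z.im : ℍ[ℝ])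

section Units

variable {I J : ℍ[ℝ]}

theorem mul_self_of_mem (hI : I ∈ imaginaryUnits) : I * I = -1 := by
  rw [← sq]; exact hI

theorem norm_of_mem (hI : I ∈ imaginaryUnits) : ‖I‖ = 1 := by
  have h : ‖I‖ ^ 2 = 1 := by rw [← norm_pow, show I ^ 2 = -1 from hI, norm_neg, norm_one]
  exact (pow_eq_one_iff_of_nonneg (norm_nonneg I) two_ne_zero).1 h

/-- Add the norm equation re² + |im|² = 1 to the real part re² - |im|² = -1 of I² = -1. -/
theorem re_of_mem (hI : I ∈ imaginaryUnits) : I.re = 0 := by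
  have h₁ : Quaternion.normSq I = 1 := by
    rw [Quaternion.normSq_eq_norm_mul_self, norm_of_mem hI, one_mul]
  have h₂ := congrArg QuaternionAlgebra.re (mul_self_of_mem hI)
  rw [Quaternion.normSq_def'] at h₁
  simp only [Quaternion.re_mul, Quaternion.re_neg, Quaternion.re_one] at h₂
  nlinarith

theorem neg_mem_imaginaryUnits (hI : I ∈ imaginaryUnits) : -I ∈ imaginaryUnits := by
  simpa [imaginaryUnits] using hI

theorem imaginaryUnits_nonempty : (imaginaryUnits : Set ℍ[ℝ]).Nonempty := by
  refine ⟨Quaternion.ofComplex Complex.I, ?_⟩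
  change Quaternion.ofComplex Complex.I ^ 2 = -1
  rw [← map_pow, Complex.I_sq, map_neg, map_one]

theorem sliceMap_neg_conj (I : ℍ[ℝ]) (z : ℂ) : sliceMap (-I) (conj z) = sliceMap I z := by
  simp [sliceMap]

@[simp] theorem sliceMap_ofReal (I : ℍ[ℝ]) (t : ℝ) : sliceMap I t = t := by
  simp [sliceMap]

/-- The algebra embedding of `ℂ` onto `ℝ + Iℝ`. -/
noncomputable def sliceHom (hI : I ∈ imaginaryUnits) : ℂ →ₐ[ℝ] ℍ[ℝ] :=
  Complex.liftAux I (mul_self_of_mem hI)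

theorem sliceHom_apply (hI : I ∈ imaginaryUnits) (z : ℂ) : sliceHom hI z = sliceMap I z := by
  rw [sliceHom, Complex.liftAux_apply, sliceMap, Algebra.smul_def]
  exact congrArg _ (Algebra.commutes _ _)

/-- The continuous real-linear embedding of `ℂ` onto `ℝ + Iℝ`. -/
noncomputable def sliceCLM (hI : I ∈ imaginaryUnits) : ℂ →L[ℝ] ℍ[ℝ] :=
  LinearMap.toContinuousLinearMap (sliceHom hI).toLinearMap

theorem sliceCLM_apply (hI : I ∈ imaginaryUnits) (z : ℂ) : sliceCLM hI z = sliceMap I z :=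
  sliceHom_apply hI z

theorem sliceMap_mul (hI : I ∈ imaginaryUnits) (z w : ℂ) :
    sliceMap I (z * w) = sliceMap I z * sliceMap I w := by
  simp only [← sliceHom_apply hI, map_mul]

theorem sliceMap_add (hI : I ∈ imaginaryUnits) (z w : ℂ) :
    sliceMap I (z + w) = sliceMap I z + sliceMap I w := by
  simp only [← sliceHom_apply hI, map_add]

theorem sliceMap_sub (hI : I ∈ imaginaryUnits) (z w : ℂ) :
    sliceMap I (z - w) = sliceMap I z - sliceMap I w := by
  simp only [← sliceHom_apply hI, map_sub]

theorem sliceMap_zpow (hI : I ∈ imaginaryUnits) (z : ℂ) (n : ℤ) :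
    sliceMap I (z ^ n) = sliceMap I z ^ n := by
  simp only [← sliceHom_apply hI, map_zpow₀]

theorem sliceMap_sum (hI : I ∈ imaginaryUnits) {κ : Type*} (s : Finset κ) (f : κ → ℂ) :
    sliceMap I (∑ i ∈ s, f i) = ∑ i ∈ s, sliceMap I (f i) := by
  simp only [← sliceHom_apply hI, map_sum]

theorem sliceMap_I (hI : I ∈ imaginaryUnits) (z : ℂ) :
    sliceMap I (Complex.I * z) = I * sliceMap I z := by
  rw [sliceMap_mul hI]
  congr 1
  simp [sliceMap]

theorem continuous_sliceMap (hI : I ∈ imaginaryUnits) : Continuous (sliceMap I) :=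
  (sliceCLM hI).continuous.congr (sliceCLM_apply hI)

theorem norm_sliceMap (hI : I ∈ imaginaryUnits) (z : ℂ) : ‖sliceMap I z‖ = ‖z‖ := by
  have h₁ : Quaternion.normSq I = 1 := by
    rw [Quaternion.normSq_eq_norm_mul_self, norm_of_mem hI, one_mul]
  have h₂ := re_of_mem hI
  rw [← sq_eq_sq₀ (norm_nonneg _) (norm_nonneg _), sq, ← Quaternion.normSq_eq_norm_mul_self,
    Complex.sq_norm, Complex.normSq_apply, Quaternion.normSq_def']
  rw [Quaternion.normSq_def'] at h₁
  simp [sliceMap, h₂] at h₁ ⊢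
  linear_combination z.im ^ 2 * h₁

theorem sliceMap_quad (hI : I ∈ imaginaryUnits) (x y : ℝ) (z : ℂ) :
    sliceMap I (quad x y z) = (sliceMap I z - (x : ℍ[ℝ])) ^ 2 + (y : ℍ[ℝ]) ^ 2 := by
  rw [quad, sq, sq, sliceMap_add hI, sliceMap_mul hI, sliceMap_mul hI, sliceMap_sub hI,
    sliceMap_ofReal, sliceMap_ofReal, sq, sq]

theorem mem_slicePlane_iff {q : ℍ[ℝ]} : q ∈ slicePlane I ↔ ∃ z, sliceMap I z = q :=
  ⟨fun ⟨x, y, h⟩ => ⟨⟨x, y⟩, h.symm⟩, fun ⟨z, h⟩ => ⟨z.re, z.im, h.symm⟩⟩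

theorem exists_sliceMap_eq (q : ℍ[ℝ]) : ∃ I ∈ imaginaryUnits, ∃ z, sliceMap I z = q := by
  rcases eq_or_ne q.im 0 with h | h
  · obtain ⟨I, hI⟩ := imaginaryUnits_nonempty
    refine ⟨I, hI, (q.re : ℂ), ?_⟩
    rw [sliceMap_ofReal]
    conv_rhs => rw [← Quaternion.re_add_im q, h, add_zero]
  · have hn : ‖q.im‖ ≠ 0 := norm_ne_zero_iff.2 h
    refine ⟨(‖q.im‖⁻¹ : ℝ) • q.im, ?_, ⟨q.re, ‖q.im‖⟩, ?_⟩
    · change ((‖q.im‖⁻¹ : ℝ) • q.im) ^ 2 = -1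
      rw [smul_pow, Quaternion.im_sq, Quaternion.normSq_eq_norm_mul_self, smul_neg,
        Quaternion.smul_coe, show ‖q.im‖⁻¹ ^ 2 * (‖q.im‖ * ‖q.im‖) = 1 by field_simp]
      rfl
    · change (q.re : ℍ[ℝ]) + (‖q.im‖⁻¹ : ℝ) • q.im * (‖q.im‖ : ℍ[ℝ]) = q
      rw [← Quaternion.coe_commutes, Quaternion.coe_mul_eq_smul, smul_smul, mul_inv_cancel₀ hn,
        one_smul, Quaternion.re_add_im]

theorem sliceMap_mem_sphere_iff (hI : I ∈ imaginaryUnits) {x y : ℝ} {z : ℂ} :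
    sliceMap I z ∈ sphere x y ↔ quad x y z = 0 := by
  constructor
  · rintro ⟨J, hJ, h⟩
    have hJ' : sliceMap I z = sliceMap J ⟨x, y⟩ := h
    have h0 : sliceMap I (quad x y z) = 0 := by
      rw [sliceMap_quad hI, hJ', ← sliceMap_quad hJ, quad_eq_zero_iff.2 (Or.inl rfl)]
      simp [sliceMap]
    rwa [← norm_eq_zero, norm_sliceMap hI, norm_eq_zero] at h0
  · intro h
    rcases quad_eq_zero_iff.1 h with rfl | rfl
    · exact ⟨I, hI, rfl⟩
    · exact ⟨-I, neg_mem_imaginaryUnits hI, by simp [sliceMap]⟩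

/-- This makes `sliceExt` independent of its choices. Two parametrizations of a nonreal quaternion
agree or differ by (I, z) ↦ (-I, conj z); at a real point every `I` is allowed, but there `h` is
real. -/
theorem sliceMap_apply_eq {h : ℂ → ℂ} (hconj : ∀ z, h (conj z) = conj (h z))
    (hI : I ∈ imaginaryUnits) (hJ : J ∈ imaginaryUnits) {z w : ℂ}
    (hzw : sliceMap I z = sliceMap J w) : sliceMap I (h z) = sliceMap J (h w) := by
  have hre : z.re = w.re := by
    have := congrArg QuaternionAlgebra.re hzw
    simpa [sliceMap, re_of_mem hI, re_of_mem hJ] using this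
  have him : I * (z.im : ℍ[ℝ]) = J * (w.im : ℍ[ℝ]) := by
    rw [sliceMap, sliceMap, hre] at hzw
    exact add_left_cancel hzw
  have habs : |z.im| = |w.im| := by
    have := congrArg norm him
    simpa [norm_mul, norm_of_mem hI, norm_of_mem hJ] using this
  rcases eq_or_ne w.im 0 with h0 | h0
  · have hz0 : z.im = 0 := by rwa [h0, abs_zero, abs_eq_zero] at habs
    have hz : z = w := Complex.ext hre (hz0.trans h0.symm)
    have hreal : (h w).im = 0 := by
      have := hconj w
      rw [Complex.conj_eq_iff_im.2 h0] at this
      exact Complex.conj_eq_iff_im.1 this.symm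
    simp [hz, sliceMap, hreal]
  · have h0' : (w.im : ℍ[ℝ]) ≠ 0 := fun h => h0 (Quaternion.coe_injective h)
    rcases abs_eq_abs.1 habs with h1 | h1
    · rw [h1] at him
      rw [mul_right_cancel₀ h0' him, Complex.ext hre h1]
    · have hIJ : J = -I := by
        rw [h1, Quaternion.coe_neg, mul_neg, ← neg_mul] at him
        exact (mul_right_cancel₀ h0' him).symm
      have hw : w = conj z := Complex.ext (by simp [hre]) (by simp [h1])
      rw [hIJ, hw, hconj, sliceMap_neg_conj]

end Units

/-- The function `x + Iy ↦ Re h(x + iy) + I Im h(x + iy)` induced by a complex function `h`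
which commutes with complex conjugation. -/
noncomputable def sliceExt (h : ℂ → ℂ) (q : ℍ[ℝ]) : ℍ[ℝ] :=
  sliceMap (exists_sliceMap_eq q).choose (h (exists_sliceMap_eq q).choose_spec.2.choose)

theorem sliceExt_sliceMap {h : ℂ → ℂ} (hconj : ∀ z, h (conj z) = conj (h z)) {I : ℍ[ℝ]}
    (hI : I ∈ imaginaryUnits) (z : ℂ) : sliceExt h (sliceMap I z) = sliceMap I (h z) :=
  sliceMap_apply_eq hconj (exists_sliceMap_eq (sliceMap I z)).choose_spec.1 hI
    (exists_sliceMap_eq (sliceMap I z)).choose_spec.2.choose_spec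

/-- The standard basis `1, i, j, k` of the quaternions. -/
def quatBasis : Fin 4 → ℍ[ℝ] := ![⟨1, 0, 0, 0⟩, ⟨0, 1, 0, 0⟩, ⟨0, 0, 1, 0⟩, ⟨0, 0, 0, 1⟩]

/-- The coordinates of a quaternion in the standard basis. -/
def quatCoord (q : ℍ[ℝ]) : Fin 4 → ℝ := ![q.re, q.imI, q.imJ, q.imK]

theorem sum_quatCoord (q : ℍ[ℝ]) : ∑ k, (quatCoord q k : ℍ[ℝ]) * quatBasis k = q := by
  simp only [Fin.sum_univ_four, Quaternion.coe_mul_eq_smul]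
  ext
  · change q.re * 1 + q.imI * 0 + q.imJ * 0 + q.imK * 0 = q.re; ring
  · change q.re * 0 + q.imI * 1 + q.imJ * 0 + q.imK * 0 = q.imI; ring
  · change q.re * 0 + q.imI * 0 + q.imJ * 1 + q.imK * 0 = q.imJ; ring
  · change q.re * 0 + q.imI * 0 + q.imJ * 0 + q.imK * 1 = q.imK; ring

/-- The quaternionic function with components induced by the functions `h k`. -/
noncomputable def stemExt (h : Fin 4 → ℂ → ℂ) (q : ℍ[ℝ]) : ℍ[ℝ] :=
  ∑ k, sliceExt (h k) q * quatBasis k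

section StemExt

variable {h : Fin 4 → ℂ → ℂ} {I : ℍ[ℝ]}

theorem stemExt_sliceMap (hconj : ∀ k z, h k (conj z) = conj (h k z)) (hI : I ∈ imaginaryUnits)
    (z : ℂ) : stemExt h (sliceMap I z) = ∑ k, sliceMap I (h k z) * quatBasis k := by
  simp only [stemExt, sliceExt_sliceMap (hconj _) hI]

/-- On a slice, ∂/∂y is left multiplication of ∂/∂x by `I`, so the operator gives 1 + I² = 0; the
constants `quatBasis k` sit on the right and do not interfere. -/
theorem isRegularOn_stemExt (hconj : ∀ k z, h k (conj z) = conj (h k z)) {U : Set ℂ}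
    (hU : IsOpen U) (hh : ∀ k, DifferentiableOn ℂ (h k) U) {Ω : Set ℍ[ℝ]}
    (hΩ : ∀ I ∈ imaginaryUnits, ∀ z, sliceMap I z ∈ Ω → z ∈ U) : IsRegularOn (stemExt h) Ω := by
  intro I hI x y hxy
  have hz : (⟨x, y⟩ : ℂ) ∈ U := hΩ I hI ⟨x, y⟩ hxy
  let e : ℝ × ℝ →L[ℝ] ℂ := (Complex.equivRealProdCLM.symm : ℝ × ℝ →L[ℝ] ℂ)
  have he : ∀ p : ℝ × ℝ, e p = ⟨p.1, p.2⟩ := fun p => by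
    apply Complex.ext <;> simp [e]
  have hd : ∀ k, HasFDerivAt (fun p => sliceCLM hI (h k (e p)) * quatBasis k)
      (((ContinuousLinearMap.mul ℝ ℍ[ℝ]).flip (quatBasis k)).comp ((sliceCLM hI).comp
        (((ContinuousLinearMap.toSpanSingleton ℂ (deriv (h k) ⟨x, y⟩)).restrictScalars ℝ).comp
          e))) (x, y) := by
    intro k
    have h₁ : HasFDerivAt (h k)
        ((ContinuousLinearMap.toSpanSingleton ℂ (deriv (h k) ⟨x, y⟩)).restrictScalars ℝ)
        (e (x, y)) := by
      rw [he]
      exact (((hh k).differentiableAt (hU.mem_nhds hz)).hasDerivAt.hasFDerivAt).restrictScalars ℝ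
    exact ((ContinuousLinearMap.mul ℝ ℍ[ℝ]).flip (quatBasis k)).hasFDerivAt.comp (x, y)
      ((sliceCLM hI).hasFDerivAt.comp (x, y) (h₁.comp (x, y) e.hasFDerivAt))
  refine ⟨_, (HasFDerivAt.fun_sum (u := Finset.univ) fun k _ => hd k).congr_of_eventuallyEq
    (Eventually.of_forall fun p => ?_), ?_⟩
  · have : stemExt h (sliceMap I (e p)) = _ := stemExt_sliceMap hconj hI (e p)
    simp only [sliceCLM_apply]
    rw [← this, he]
    rfl
  · simp only [_root_.sum_apply, ContinuousLinearMap.comp_apply,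
      ContinuousLinearMap.flip_apply, ContinuousLinearMap.mul_apply',
      ContinuousLinearMap.coe_restrictScalars', ContinuousLinearMap.toSpanSingleton_apply,
      sliceCLM_apply, he, Finset.mul_sum, ← Finset.sum_add_distrib, smul_eq_mul]
    refine Finset.sum_eq_zero fun k _ => ?_
    have h1 : (⟨1, 0⟩ : ℂ) = 1 := rfl
    have h2 : (⟨0, 1⟩ : ℂ) = Complex.I := rfl
    rw [h1, h2, one_mul, sliceMap_I hI, ← mul_assoc, ← mul_assoc, mul_self_of_mem hI, neg_one_mul,
      neg_mul, add_neg_cancel]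

theorem hasLaurentExpansion_stemExt (hconj : ∀ k z, h k (conj z) = conj (h k z)) {a : ℂ}
    (hm : ∀ k, MeromorphicAt (h k) a) (hI : I ∈ imaginaryUnits) {Ω : Set ℍ[ℝ]}
    (hΩ : ∀ᶠ z in 𝓝[≠] a, sliceMap I z ∈ Ω) :
    ∃ (c : ℤ → ℍ[ℝ]) (m : ℕ), HasLaurentExpansion (stemExt h) Ω I (sliceMap I a) c ∧
      ∀ k : ℕ, m < k → c (-(k : ℤ)) = 0 := by
  have hex : ∀ k, ∃ (m : ℕ) (c : ℤ → ℂ) (r : ℝ), 0 < r ∧ (∀ j : ℕ, m < j → c (-(j : ℤ)) = 0) ∧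
      ∀ z, 0 < ‖z - a‖ → ‖z - a‖ < r → HasSum (fun n => (z - a) ^ n * c n) (h k z) := by
    intro k
    obtain ⟨m, hG⟩ := hm k
    refine ⟨m, exists_hasSum_zpow ⟨_, hG, ?_⟩⟩
    filter_upwards [self_mem_nhdsWithin] with z hz
    have hne : z - a ≠ 0 := sub_ne_zero.2 hz
    rw [zpow_neg, zpow_natCast, smul_eq_mul, inv_mul_cancel_left₀ (pow_ne_zero m hne)]
  choose m c r hr hc hs using hex
  obtain ⟨R, hR, hΩR⟩ := Metric.eventually_nhds_iff_ball.1 (eventually_nhdsWithin_iff.1 hΩ)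
  -- The sum of the four orders serves as a common bound for them.
  refine ⟨fun n => ∑ k, sliceMap I (c k n) * quatBasis k, ∑ k, m k,
    ⟨min R (Finset.univ.inf' Finset.univ_nonempty r), ?_, ?_⟩, fun j hj => ?_⟩
  · exact lt_min hR ((Finset.lt_inf'_iff _).2 fun k _ => hr k)
  · intro q hq h0 h1
    obtain ⟨z, rfl⟩ := mem_slicePlane_iff.1 hq
    rw [← sliceMap_sub hI, norm_sliceMap hI] at h0 h1
    refine ⟨hΩR z (by simpa [dist_eq_norm] using h1.trans_le (min_le_left _ _))
      (sub_ne_zero.1 (norm_pos_iff.1 h0)), ?_⟩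
    have hk : ∀ k, ‖z - a‖ < r k := fun k => h1.trans_le
      ((min_le_right _ _).trans (Finset.inf'_le _ (Finset.mem_univ k)))
    have := hasSum_sum (s := Finset.univ) fun k _ =>
      ((sliceCLM hI).hasSum (hs k z h0 (hk k))).mul_right (quatBasis k)
    refine hasSum_of_eq this (fun n => ?_) ?_
    · simp only [sliceCLM_apply, Finset.mul_sum, sliceMap_mul hI,
        sliceMap_zpow hI, sliceMap_sub hI, mul_assoc]
    · simp only [sliceCLM_apply, stemExt_sliceMap hconj hI]
  · refine Finset.sum_eq_zero fun k _ => ?_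
    rw [hc k j ((Finset.single_le_sum (fun _ _ => Nat.zero_le _) (Finset.mem_univ k)).trans_lt hj)]
    simp [sliceMap]

/-- Write q - q₀ = (q - q₁) + (q₁ - q₀). With q₁ = x real, the term becomes accessible to complex
functions with real coefficients. -/
theorem sphericalTerm_change_center (x y : ℝ) (q₀ q₁ : ℍ[ℝ]) (n : ℤ) (a b q : ℍ[ℝ]) :
    sphericalTerm x y q₀ n a b q = sphericalTerm x y q₁ n (a + (q₁ - q₀) * b) b q := by
  rw [sphericalTerm, sphericalTerm]
  congr 1
  noncomm_ring

theorem sum_sliceMap_quad (hI : I ∈ imaginaryUnits) (x y : ℝ) (n : ℤ) (c d : Fin 4 → ℝ) (z : ℂ) :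
    ∑ k, sliceMap I (quad x y z ^ n * (c k + (z - x) * d k)) * quatBasis k =
      sphericalTerm x y x n (∑ k, (c k : ℍ[ℝ]) * quatBasis k) (∑ k, (d k : ℍ[ℝ]) * quatBasis k)
        (sliceMap I z) := by
  rw [sphericalTerm, ← sliceMap_quad hI, ← sliceMap_zpow hI, Finset.mul_sum,
    ← Finset.sum_add_distrib, Finset.mul_sum]
  refine Finset.sum_congr rfl fun k _ => ?_
  simp only [sliceMap_mul hI, sliceMap_add hI, sliceMap_sub hI, sliceMap_ofReal]
  noncomm_ring

end StemExt

/-! ### Symmetric slice domains and their plane stem domains -/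

/-- The points `x + iy` over which a symmetric set of quaternions lies. -/
def stemDomain (Ω : Set ℍ[ℝ]) : Set ℂ := {z | ∃ I ∈ imaginaryUnits, sliceMap I z ∈ Ω}

section Domain

variable {ι : Type*} {Ω : Set ℍ[ℝ]} {x y : ι → ℝ} {I : ℍ[ℝ]}

theorem sliceMap_mem_iff (hΩ : IsSymmetricSliceDomain Ω) (hI : I ∈ imaginaryUnits) {z : ℂ} :
    sliceMap I z ∈ Ω ↔ z ∈ stemDomain Ω :=
  ⟨fun h => ⟨I, hI, h⟩, fun ⟨J, hJ, h⟩ => hΩ.symmetric z.re z.im J hJ h ⟨I, hI, rfl⟩⟩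

theorem isOpen_stemDomain (hΩ : IsSymmetricSliceDomain Ω) : IsOpen (stemDomain Ω) := by
  obtain ⟨I, hI⟩ := imaginaryUnits_nonempty
  have : stemDomain Ω = sliceMap I ⁻¹' Ω := ext fun z => (sliceMap_mem_iff hΩ hI).symm
  rw [this]
  exact hΩ.isOpen.preimage (continuous_sliceMap hI)

theorem conj_mem_stemDomain {z : ℂ} (hz : z ∈ stemDomain Ω) : conj z ∈ stemDomain Ω := by
  obtain ⟨I, hI, h⟩ := hz
  exact ⟨-I, neg_mem_imaginaryUnits hI, by rwa [sliceMap_neg_conj]⟩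

/-- The stem domain is a continuous image of one slice of Ω, the coordinates of q = x + Iy being Re
q and -Re(Iq). -/
theorem isPreconnected_stemDomain (hΩ : IsSymmetricSliceDomain Ω) :
    IsPreconnected (stemDomain Ω) := by
  obtain ⟨I, hI⟩ := imaginaryUnits_nonempty
  have hinv : ∀ z, (⟨(sliceMap I z).re, -(I * sliceMap I z).re⟩ : ℂ) = z := by
    intro z
    have h : I * sliceMap I z = sliceMap I (Complex.I * z) := (sliceMap_I hI z).symm
    rw [h]
    apply Complex.ext <;> simp [sliceMap, re_of_mem hI]
  have himg : stemDomain Ω =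
      (fun q : ℍ[ℝ] => (⟨q.re, -(I * q).re⟩ : ℂ)) '' (Ω ∩ slicePlane I) := by
    ext z
    constructor
    · intro hz
      exact ⟨sliceMap I z, ⟨(sliceMap_mem_iff hΩ hI).2 hz, mem_slicePlane_iff.2 ⟨z, rfl⟩⟩, hinv z⟩
    · rintro ⟨q, ⟨hq, hqI⟩, rfl⟩
      obtain ⟨w, rfl⟩ := mem_slicePlane_iff.1 hqI
      dsimp only
      rw [hinv]
      exact (sliceMap_mem_iff hΩ hI).1 hq
  rw [himg]
  refine (hΩ.slice_isConnected I hI).isPreconnected.image _ (Continuous.continuousOn ?_)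
  have h₁ : Continuous fun q : ℍ[ℝ] => (q.re, -(I * q).re) :=
    Quaternion.continuous_re.prodMk
      (Quaternion.continuous_re.comp (continuous_const.mul continuous_id)).neg
  exact Complex.equivRealProdCLM.symm.continuous.comp h₁

theorem sliceMap_mem_iUnion_sphere_iff (hI : I ∈ imaginaryUnits) {z : ℂ} :
    sliceMap I z ∈ ⋃ α, sphere (x α) (y α) ↔ z ∈ zeros x y univ := by
  simp [zeros, sliceMap_mem_sphere_iff hI]

theorem mem_stemDomain_of_quad (hS : IsClosedDiscreteFamily Ω x y) (α : ι) (z : ℂ)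
    (hz : quad (x α) (y α) z = 0) : z ∈ stemDomain Ω := by
  obtain ⟨I, hI⟩ := imaginaryUnits_nonempty
  exact ⟨I, hI, hS.subset α ((sliceMap_mem_sphere_iff hI).2 hz)⟩

/-- By compactness this is local: a point on some sphere has a neighbourhood meeting only that one,
by discreteness; any other point of Ω has one meeting none, by closedness. -/
theorem finite_inter_sphere (hS : IsClosedDiscreteFamily Ω x y) {K : Set ℍ[ℝ]} (hK : IsCompact K)
    (hKΩ : K ⊆ Ω) : {α | (sphere (x α) (y α) ∩ K).Nonempty}.Finite := by
  obtain ⟨C, hC, hCΩ⟩ := hS.closed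
  refine hK.induction_on (p := fun s => {α | (sphere (x α) (y α) ∩ s).Nonempty}.Finite)
    (by simp) ?_ ?_ ?_
  · exact fun s t hst ht => ht.subset fun α hα => hα.mono (inter_subset_inter_right _ hst)
  · intro s t hs ht
    refine (hs.union ht).subset fun α hα => ?_
    rwa [mem_ofPred_eq, inter_union_distrib_left, union_nonempty] at hα
  · intro q hq
    by_cases hqC : q ∈ C
    · have : q ∈ ⋃ α, sphere (x α) (y α) := hCΩ ▸ ⟨hKΩ hq, hqC⟩
      obtain ⟨β, hβ⟩ := mem_iUnion.1 this
      obtain ⟨V, hV, hβV, hdisj⟩ := hS.discrete β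
      refine ⟨V, mem_nhdsWithin_of_mem_nhds (hV.mem_nhds (hβV hβ)),
        (finite_singleton β).subset fun α hα => ?_⟩
      by_contra hne
      obtain ⟨p, hp, hpV⟩ := hα
      exact disjoint_left.1 (hdisj α hne) hpV hp
    · refine ⟨Cᶜ, mem_nhdsWithin_of_mem_nhds (hC.isOpen_compl.mem_nhds hqC),
        finite_empty.subset fun α hα => ?_⟩
      obtain ⟨p, hp, hpC⟩ := hα
      have : p ∈ Ω ∩ C := hCΩ ▸ mem_iUnion.2 ⟨α, hp⟩
      exact hpC this.2

theorem finite_zeros_inter (hΩ : IsSymmetricSliceDomain Ω) (hS : IsClosedDiscreteFamily Ω x y)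
    (K : Set ℂ) (hKD : K ⊆ stemDomain Ω) (hK : IsCompact K) :
    {α | ∃ z ∈ K, quad (x α) (y α) z = 0}.Finite := by
  obtain ⟨I, hI⟩ := imaginaryUnits_nonempty
  refine (finite_inter_sphere hS (hK.image (continuous_sliceMap hI)) ?_).subset ?_
  · rintro - ⟨z, hz, rfl⟩
    exact (sliceMap_mem_iff hΩ hI).2 (hKD hz)
  · rintro α ⟨z, hz, h0⟩
    exact ⟨sliceMap I z, (sliceMap_mem_sphere_iff hI).2 h0, z, hz, rfl⟩

theorem notMem_zeros_compl (hS : IsClosedDiscreteFamily Ω x y) {α : ι} {z : ℂ}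
    (hz : quad (x α) (y α) z = 0) : z ∉ zeros x y {α}ᶜ := by
  rintro ⟨β, hβ, h0⟩
  obtain ⟨I, hI⟩ := imaginaryUnits_nonempty
  obtain ⟨V, -, hV, hdisj⟩ := hS.discrete α
  exact disjoint_left.1 (hdisj β hβ) (hV ((sliceMap_mem_sphere_iff hI).2 hz))
    ((sliceMap_mem_sphere_iff hI).2 h0)

theorem sliceMap_mem_diff_iff (hΩ : IsSymmetricSliceDomain Ω) (hI : I ∈ imaginaryUnits) {z : ℂ} :
    sliceMap I z ∈ Ω \ ⋃ α, sphere (x α) (y α) ↔ z ∈ stemDomain Ω \ zeros x y univ := by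
  rw [Set.mem_sdiff, Set.mem_sdiff, sliceMap_mem_iff hΩ hI, sliceMap_mem_iUnion_sphere_iff hI]

/-- Removing a closed discrete family of spheres from a symmetric slice domain leaves a symmetric
slice domain. -/
theorem isSymmetricSliceDomain_diff (hΩ : IsSymmetricSliceDomain Ω)
    (hS : IsClosedDiscreteFamily Ω x y) :
    IsSymmetricSliceDomain (Ω \ ⋃ α, sphere (x α) (y α)) := by
  have hD := isOpen_stemDomain hΩ
  have := countable_index hD (mem_stemDomain_of_quad hS) (finite_zeros_inter hΩ hS)
  have hZ : (zeros x y univ).Countable := countable_zeros univ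
  have hpre : IsPreconnected (stemDomain Ω \ zeros x y univ) :=
    isPreconnected_diff_countable hD (isPreconnected_stemDomain hΩ) hZ
  -- Countably many zeros cannot fill a nonempty open set of reals. The point `t` lies in every
  -- slice, so the connected slices together form a connected set.
  obtain ⟨t, ht⟩ : ∃ t : ℝ, (t : ℂ) ∈ stemDomain Ω \ zeros x y univ := by
    obtain ⟨t₀, ht₀⟩ := hΩ.meets_real
    obtain ⟨I, hI⟩ := imaginaryUnits_nonempty
    rw [← sliceMap_ofReal I, sliceMap_mem_iff hΩ hI] at ht₀
    obtain ⟨t, ht, htZ⟩ := ((hZ.preimage Complex.ofReal_injective).dense_compl ℝ).inter_open_nonempty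
      _ (hD.preimage Complex.continuous_ofReal) ⟨t₀, ht₀⟩
    exact ⟨t, ht, htZ⟩
  have hslice : ∀ I ∈ imaginaryUnits, (Ω \ ⋃ α, sphere (x α) (y α)) ∩ slicePlane I =
      sliceMap I '' (stemDomain Ω \ zeros x y univ) := by
    intro I hI
    ext q
    constructor
    · rintro ⟨hq, hqI⟩
      obtain ⟨z, rfl⟩ := mem_slicePlane_iff.1 hqI
      exact ⟨z, (sliceMap_mem_diff_iff hΩ hI).1 hq, rfl⟩
    · rintro ⟨z, hz, rfl⟩
      exact ⟨(sliceMap_mem_diff_iff hΩ hI).2 hz, mem_slicePlane_iff.2 ⟨z, rfl⟩⟩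
  have hsliceConn : ∀ I ∈ imaginaryUnits,
      IsConnected ((Ω \ ⋃ α, sphere (x α) (y α)) ∩ slicePlane I) := by
    intro I hI
    rw [hslice I hI]
    exact ⟨⟨_, t, ht, rfl⟩, hpre.image _ (continuous_sliceMap hI).continuousOn⟩
  have htΩ : ∀ I ∈ imaginaryUnits, (t : ℍ[ℝ]) ∈ (Ω \ ⋃ α, sphere (x α) (y α)) ∩ slicePlane I := by
    intro I hI
    rw [hslice I hI]
    exact ⟨t, ht, sliceMap_ofReal I t⟩
  obtain ⟨I₀, hI₀⟩ := imaginaryUnits_nonempty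
  refine ⟨?_, ⟨⟨t, (htΩ I₀ hI₀).1⟩, isPreconnected_of_forall (t : ℍ[ℝ]) fun q hq => ?_⟩, ?_,
    ⟨t, (htΩ I₀ hI₀).1⟩, hsliceConn⟩
  · obtain ⟨C, hC, hCΩ⟩ := hS.closed
    rw [hCΩ, sdiff_self_inter]
    exact hΩ.isOpen.sdiff hC
  · obtain ⟨I, hI, z, rfl⟩ := exists_sliceMap_eq q
    exact ⟨_, inter_subset_left, htΩ I hI, ⟨hq, mem_slicePlane_iff.2 ⟨z, rfl⟩⟩,
      (hsliceConn I hI).isPreconnected⟩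
  · rintro a b I hI hab - ⟨J, hJ, rfl⟩
    exact (sliceMap_mem_diff_iff hΩ hJ (z := ⟨a, b⟩)).2
      ((sliceMap_mem_diff_iff hΩ hI (z := ⟨a, b⟩)).1 hab)

end Domain

/-! ### Reading off principal parts -/

/-- If the product of the distances from `z` to the two roots is below R², one of them is below R.
-/
theorem exists_quad_lt_subset {U : Set ℂ} (hU : IsOpen U) {x y : ℝ} (h₁ : (⟨x, y⟩ : ℂ) ∈ U)
    (h₂ : (⟨x, -y⟩ : ℂ) ∈ U) : ∃ R : ℝ, 0 < R ∧ ∀ z, ‖quad x y z‖ < R ^ 2 → z ∈ U := by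
  obtain ⟨r₁, hr₁, hb₁⟩ := Metric.isOpen_iff.1 hU _ h₁
  obtain ⟨r₂, hr₂, hb₂⟩ := Metric.isOpen_iff.1 hU _ h₂
  refine ⟨min r₁ r₂, lt_min hr₁ hr₂, fun z hz => ?_⟩
  have hR : 0 < min r₁ r₂ := lt_min hr₁ hr₂
  rw [quad_eq_mul, norm_mul] at hz
  by_cases h : ‖z - ⟨x, y⟩‖ < min r₁ r₂
  · exact hb₁ (by rw [mem_ball, dist_eq_norm]; exact h.trans_le (min_le_left _ _))
  · refine hb₂ ?_
    rw [mem_ball, dist_eq_norm]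
    refine lt_of_lt_of_le ?_ (min_le_right r₁ r₂)
    by_contra h'
    push Not at h h'
    nlinarith [mul_le_mul h h' hR.le (norm_nonneg _)]

/-- The sequence `a 0, b 0, a 1, b 1, …`. -/
def interleave (a b : ℕ → ℍ[ℝ]) (i : ℕ) : ℍ[ℝ] := if i % 2 = 0 then a (i / 2) else b (i / 2)

theorem interleave_even (a b : ℕ → ℍ[ℝ]) (j : ℕ) : interleave a b (2 * j) = a j := by
  simp [interleave]

theorem interleave_odd (a b : ℕ → ℍ[ℝ]) (j : ℕ) : interleave a b (2 * j + 1) = b j := by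
  have h : (2 * j + 1) / 2 = j := by omega
  have h' : (2 * j + 1) % 2 ≠ 0 := by omega
  simp [interleave, h]

/-- A function which is the sum of a finite principal part and a spherical power series has this
principal part. -/
theorem hasPrincipalPart_of_hasSum {f : ℍ[ℝ] → ℍ[ℝ]} {Ω : Set ℍ[ℝ]} {x y : ℝ} {q₁ : ℍ[ℝ]}
    {m : ℕ} {A c d : ℕ → ℍ[ℝ]} {R : ℝ} (hR : 0 < R)
    (h : ∀ q ∈ sphereNhd x y R \ sphere x y, q ∈ Ω ∧ ∃ g,
      HasSum (fun j : ℕ => sphericalTerm x y x j (c j) (d j) q) g ∧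
      f q = ∑ n ∈ Finset.Icc 1 m,
        sphericalTerm x y q₁ (-(n : ℤ)) (A (2 * n)) (A (2 * n + 1)) q + g) :
    HasPrincipalPart f Ω x y fun p => ∑ n ∈ Finset.Icc 1 m,
      sphericalTerm x y q₁ (-(n : ℤ)) (A (2 * n)) (A (2 * n + 1)) p := by
  classical
  intro q₀ _
  -- The prescribed top coefficients may vanish, whereas the expansion must start with a nonzero
  -- pair; `K` is the true order.
  let P : ℕ → Prop := fun n => A (2 * n) ≠ 0 ∨ A (2 * n + 1) ≠ 0
  let K := Nat.findGreatest P m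
  have hK : K = 0 ∨ P K := or_iff_not_imp_left.2 fun h0 => Nat.findGreatest_of_ne_zero rfl h0
  have hKm : K ≤ m := Nat.findGreatest_le m
  have hzero : ∀ n, K < n → n ≤ m → A (2 * n) = 0 ∧ A (2 * n + 1) = 0 := by
    intro n h₁ h₂
    have := Nat.findGreatest_is_greatest h₁ h₂
    simpa [P, not_or] using this
  have hsum : ∀ q, ∑ n ∈ Finset.Icc 1 m,
      sphericalTerm x y q₁ (-(n : ℤ)) (A (2 * n)) (A (2 * n + 1)) q =
      ∑ n ∈ Finset.Icc 1 K,
        sphericalTerm x y q₀ (-(n : ℤ)) (A (2 * n) + (q₀ - q₁) * A (2 * n + 1))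
          (A (2 * n + 1)) q := by
    intro q
    rw [← Finset.sum_subset (Finset.Icc_subset_Icc_right hKm)]
    · exact Finset.sum_congr rfl fun n _ => sphericalTerm_change_center _ _ _ _ _ _ _ _
    · intro n hn hn'
      rw [Finset.mem_Icc] at hn hn'
      obtain ⟨h0, h1⟩ := hzero n (by omega) hn.2
      simp [sphericalTerm, h0, h1]
  -- Index `j` carries the exponent j - K. Both pieces are recentred at `q₀`: the polar one from
  -- `q₁`, the regular one from `x`.
  let a : ℕ → ℍ[ℝ] := fun j => if j < K then A (2 * (K - j)) + (q₀ - q₁) * A (2 * (K - j) + 1)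
    else c (j - K) + (q₀ - x) * d (j - K)
  let b : ℕ → ℍ[ℝ] := fun j => if j < K then A (2 * (K - j) + 1) else d (j - K)
  have hpole : ∀ n ∈ Finset.Icc 1 K, a (K - n) = A (2 * n) + (q₀ - q₁) * A (2 * n + 1) ∧
      b (K - n) = A (2 * n + 1) := by
    intro n hn
    rw [Finset.mem_Icc] at hn
    have h₁ : K - n < K := by omega
    have h₂ : K - (K - n) = n := by omega
    simp [a, b, h₁, h₂]
  refine ⟨K, interleave a b, ⟨⟨R, hR, fun q hq => ?_⟩, ?_⟩, fun q _ => ?_⟩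
  · obtain ⟨hqΩ, g, hg, hf⟩ := h q hq
    refine ⟨hqΩ, ?_⟩
    simp only [interleave_even, interleave_odd]
    have hfirst : ∑ n ∈ Finset.Icc 1 K,
        sphericalTerm x y q₀ (-(n : ℤ)) (A (2 * n) + (q₀ - q₁) * A (2 * n + 1)) (A (2 * n + 1)) q =
        ∑ j ∈ Finset.range K, sphericalTerm x y q₀ ((j : ℤ) - K) (a j) (b j) q := by
      refine Finset.sum_nbij' (fun n => K - n) (fun j => K - j) ?_ ?_ ?_ ?_ ?_
      · intro n hn; rw [Finset.mem_Icc] at hn; rw [Finset.mem_range]; omega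
      · intro j hj; rw [Finset.mem_range] at hj; rw [Finset.mem_Icc]; omega
      · intro n hn; rw [Finset.mem_Icc] at hn; omega
      · intro j hj; rw [Finset.mem_range] at hj; omega
      · intro n hn
        rw [(hpole n hn).1, (hpole n hn).2]
        rw [Finset.mem_Icc] at hn
        congr 1
        omega
    rw [hf, hsum, hfirst, add_comm, ← hasSum_nat_add_iff]
    refine hasSum_of_eq hg (fun j => ?_) rfl
    have h₁ : ¬ j + K < K := by omega
    simp only [a, b, h₁, if_false, Nat.add_sub_cancel]
    rw [sphericalTerm_change_center x y x q₀]
    congr 1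
    push_cast
    ring
  · rcases Nat.eq_zero_or_pos K with h0 | h0
    · exact Or.inl h0
    right
    have hA := hK.resolve_left h0.ne'
    have e₀ : interleave a b 0 = A (2 * K) + (q₀ - q₁) * A (2 * K + 1) := by
      simpa [a, h0] using interleave_even a b 0
    have e₁ : interleave a b 1 = A (2 * K + 1) := by
      simpa [b, h0] using interleave_odd a b 0
    rw [e₀, e₁]
    by_cases h1 : A (2 * K + 1) = 0
    · left
      rw [h1, mul_zero, add_zero]
      exact hA.resolve_right (not_not.2 h1)
    · exact Or.inr h1
  · dsimp only
    rw [hsum]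
    refine Finset.sum_congr rfl fun n hn => ?_
    rw [interleave_even, interleave_odd, (hpole n hn).1, (hpole n hn).2]

/-! ### The induced function near a prescribed sphere -/

section Solution

variable {ι : Type*} {Ω : Set ℍ[ℝ]} {x y : ι → ℝ}

theorem mem_diff_zeros_univ {D : Set ℂ} {α : ι} {z : ℂ} (hz : z ∈ D \ zeros x y {α}ᶜ)
    (h0 : quad (x α) (y α) z ≠ 0) : z ∈ D \ zeros x y univ := by
  refine ⟨hz.1, fun ⟨β, _, hβ⟩ => ?_⟩
  by_cases h : β = α
  · exact h0 (h ▸ hβ)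
  · exact hz.2 ⟨β, h, hβ⟩

theorem meromorphicAt_of_polePart {D : Set ℂ} {α : ι} (hU : IsOpen (D \ zeros x y {α}ᶜ))
    {h g : ℂ → ℂ} {m : ℕ} {c d : ℕ → ℝ} (hg : DifferentiableOn ℂ g (D \ zeros x y {α}ᶜ))
    (hgh : ∀ z ∈ D \ zeros x y univ, h z = polePart (x α) (y α) m c d z + g z) {a : ℂ}
    (ha : a ∈ D \ zeros x y {α}ᶜ) :
    MeromorphicAt h a ∧ ∀ᶠ z in 𝓝[≠] a, z ∈ D \ zeros x y univ := by
  have hq : AnalyticAt ℂ (quad (x α) (y α)) a := (differentiable_quad _ _).analyticAt a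
  have hne : ∀ᶠ z in 𝓝[≠] a, quad (x α) (y α) z ≠ 0 := by
    have hfin : {z | quad (x α) (y α) z = 0}.Finite := by
      refine (((finite_singleton (⟨x α, -y α⟩ : ℂ)).insert ⟨x α, y α⟩)).subset fun z hz => ?_
      exact quad_eq_zero_iff.1 hz
    have hcl := (hfin.subset sdiff_subset : ({z | quad (x α) (y α) z = 0} \ {a}).Finite).isClosed
    have : ({z | quad (x α) (y α) z = 0} \ {a})ᶜ ∈ 𝓝 a :=
      hcl.isOpen_compl.mem_nhds fun h => h.2 rfl
    filter_upwards [mem_nhdsWithin_of_mem_nhds this, self_mem_nhdsWithin] with z hz hza h0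
    exact hz ⟨h0, hza⟩
  have hev : ∀ᶠ z in 𝓝[≠] a, z ∈ D \ zeros x y univ := by
    filter_upwards [mem_nhdsWithin_of_mem_nhds (hU.mem_nhds ha), hne] with z hz h0
      using mem_diff_zeros_univ hz h0
  refine ⟨?_, hev⟩
  have hp : MeromorphicAt (polePart (x α) (y α) m c d) a := by
    refine MeromorphicAt.fun_sum fun n _ => ?_
    have : AnalyticAt ℂ (fun z : ℂ => c n + (z - x α) * d n) a := by fun_prop
    exact (hq.meromorphicAt.zpow _).mul this.meromorphicAt
  refine (hp.add (hg.analyticAt (hU.mem_nhds ha)).meromorphicAt).congr ?_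
  filter_upwards [hev] with z hz
  rw [hgh z hz]
  rfl

/-- The real data fed to the complex theorem are the coordinates of the coefficients after
recentring at the real point `a`. -/
theorem sum_sliceMap_polePart {I : ℍ[ℝ]} (hI : I ∈ imaginaryUnits) (a b : ℝ) (q₁ : ℍ[ℝ]) (m : ℕ)
    (A : ℕ → ℍ[ℝ]) (z : ℂ) :
    ∑ k, sliceMap I (polePart a b m
      (fun n => quatCoord (A (2 * n) + (a - q₁) * A (2 * n + 1)) k)
      (fun n => quatCoord (A (2 * n + 1)) k) z) * quatBasis k =
    ∑ n ∈ Finset.Icc 1 m,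
      sphericalTerm a b q₁ (-(n : ℤ)) (A (2 * n)) (A (2 * n + 1)) (sliceMap I z) := by
  simp only [polePart, sliceMap_sum hI, Finset.sum_mul]
  rw [Finset.sum_comm]
  refine Finset.sum_congr rfl fun n _ => ?_
  rw [sphericalTerm_change_center a b q₁ a]
  have := sum_sliceMap_quad hI a b (-(n : ℤ))
    (quatCoord (A (2 * n) + (a - q₁) * A (2 * n + 1))) (quatCoord (A (2 * n + 1))) z
  rwa [sum_quatCoord, sum_quatCoord] at this

theorem hasPrincipalPart_stemExt (hΩ : IsSymmetricSliceDomain Ω)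
    (hS : IsClosedDiscreteFamily Ω x y) {h : Fin 4 → ℂ → ℂ}
    (hconj : ∀ k z, h k (conj z) = conj (h k z)) (α : ι) (q₁ : ℍ[ℝ]) (m : ℕ) (A : ℕ → ℍ[ℝ])
    {g : Fin 4 → ℂ → ℂ} (hgconj : ∀ k z, g k (conj z) = conj (g k z))
    (hg : ∀ k, DifferentiableOn ℂ (g k) (stemDomain Ω \ zeros x y {α}ᶜ))
    (hgh : ∀ k, ∀ z ∈ stemDomain Ω \ zeros x y univ, h k z = polePart (x α) (y α) m
      (fun n => quatCoord (A (2 * n) + (x α - q₁) * A (2 * n + 1)) k)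
      (fun n => quatCoord (A (2 * n + 1)) k) z + g k z) :
    HasPrincipalPart (stemExt h) (Ω \ ⋃ α, sphere (x α) (y α)) (x α) (y α) fun p =>
      ∑ n ∈ Finset.Icc 1 m,
        sphericalTerm (x α) (y α) q₁ (-(n : ℤ)) (A (2 * n)) (A (2 * n + 1)) p := by
  have hU := isOpen_diff_zeros (isOpen_stemDomain hΩ) (finite_zeros_inter hΩ hS) {α}ᶜ
  have hmem : ∀ z, quad (x α) (y α) z = 0 → z ∈ stemDomain Ω \ zeros x y {α}ᶜ := fun z hz =>
    ⟨mem_stemDomain_of_quad hS α z hz, notMem_zeros_compl hS hz⟩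
  have h₁ := hmem _ (quad_eq_zero_iff.2 (Or.inl rfl))
  have h₂ := hmem _ (quad_eq_zero_iff.2 (Or.inr rfl))
  obtain ⟨R₁, hR₁, hR₁U⟩ := exists_quad_lt_subset hU h₁ h₂
  choose c d r hr hs using fun k => exists_hasSum_quad (hgconj k)
    ((hg k).analyticAt (hU.mem_nhds h₁)) ((hg k).analyticAt (hU.mem_nhds h₂))
  let ρ := Finset.univ.inf' Finset.univ_nonempty r
  have hρ : 0 < ρ := (Finset.lt_inf'_iff _).2 fun k _ => hr k
  -- The neighbourhood is given by |quad| < R², the series by |quad| < ρ; R ≤ 1 yields R² ≤ R ≤ ρ.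
  let R := min R₁ (min 1 ρ)
  have hR : 0 < R := by positivity
  have hRR₁ : R ≤ R₁ := min_le_left _ _
  have hR1 : R ≤ 1 := (min_le_right _ _).trans (min_le_left _ _)
  have hRρ : R ≤ ρ := (min_le_right _ _).trans (min_le_right _ _)
  refine hasPrincipalPart_of_hasSum (R := R)
    (c := fun j => ∑ k, (c k j : ℍ[ℝ]) * quatBasis k)
    (d := fun j => ∑ k, (d k j : ℍ[ℝ]) * quatBasis k) hR ?_
  rintro q ⟨hqR, hqS⟩
  obtain ⟨I, hI, z, rfl⟩ := exists_sliceMap_eq q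
  have hzR : ‖quad (x α) (y α) z‖ < R ^ 2 := by
    rw [← norm_sliceMap hI, sliceMap_quad hI]
    exact hqR
  rw [sliceMap_mem_sphere_iff hI] at hqS
  have hzU := mem_diff_zeros_univ (hR₁U z (hzR.trans_le (by gcongr))) hqS
  refine ⟨(sliceMap_mem_diff_iff hΩ hI).2 hzU, ∑ k, sliceMap I (g k z) * quatBasis k, ?_, ?_⟩
  · have hzk : ∀ k, ‖quad (x α) (y α) z‖ < r k := fun k => by
      have : ρ ≤ r k := Finset.inf'_le _ (Finset.mem_univ k)
      nlinarith
    have := hasSum_sum (s := Finset.univ) fun k _ =>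
      ((sliceCLM hI).hasSum (hs k z (hzk k))).mul_right (quatBasis k)
    refine hasSum_of_eq this (fun j => ?_) ?_
    · rw [← sum_sliceMap_quad hI]
      simp only [sliceCLM_apply, zpow_natCast]
    · simp only [sliceCLM_apply]
  · rw [stemExt_sliceMap hconj hI, ← sum_sliceMap_polePart hI, ← Finset.sum_add_distrib]
    refine Finset.sum_congr rfl fun k _ => ?_
    rw [hgh k z hzU, sliceMap_add hI, add_mul]

end Solution

end SliceRegular

theorem mainTheorem1 {ι : Type*} (Ω : Set ℍ[ℝ]) (hΩ : SliceRegular.IsSymmetricSliceDomain Ω)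
    (x y : ι → ℝ) (hS : SliceRegular.IsClosedDiscreteFamily Ω x y)
    (q : ι → ℍ[ℝ]) (hq : ∀ α, q α ∈ SliceRegular.sphere (x α) (y α))
    (m : ι → ℕ) (A : ι → ℕ → ℍ[ℝ]) :
    ∃ (Ω' : Set ℍ[ℝ]) (f : ℍ[ℝ] → ℍ[ℝ]),
      SliceRegular.IsSemiregularOn f Ω' Ω ∧
      (∀ α, SliceRegular.HasPrincipalPart f Ω' (x α) (y α)
        (fun p => ∑ n ∈ Finset.Icc 1 (m α),
          SliceRegular.sphericalTerm (x α) (y α) (q α) (-(n : ℤ))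
            (A α (2 * n)) (A α (2 * n + 1)) p)) ∧
      (∀ p ∈ Ω, SliceRegular.IsPole f Ω' p → ∃ α, p ∈ SliceRegular.sphere (x α) (y α)) := by
  have hD := SliceRegular.isOpen_stemDomain hΩ
  have hfin := SliceRegular.finite_zeros_inter hΩ hS
  choose h hconj hdiff g hgconj hg hgh using fun k : Fin 4 =>
    SliceRegular.exists_mittagLeffler hD (fun z hz => SliceRegular.conj_mem_stemDomain hz)
      (SliceRegular.mem_stemDomain_of_quad hS) hfin m
      (fun α n => SliceRegular.quatCoord
        (A α (2 * n) + (x α - q α) * A α (2 * n + 1)) k)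
      (fun α n => SliceRegular.quatCoord (A α (2 * n + 1)) k)
  have hopen := SliceRegular.isOpen_diff_zeros hD hfin
  have hreg : SliceRegular.IsRegularOn (SliceRegular.stemExt h)
      (Ω \ ⋃ α, SliceRegular.sphere (x α) (y α)) :=
    SliceRegular.isRegularOn_stemExt hconj (hopen _) hdiff
      fun I hI z hz => (SliceRegular.sliceMap_mem_diff_iff hΩ hI).1 hz
  have hdom := SliceRegular.isSymmetricSliceDomain_diff hΩ hS
  refine ⟨Ω \ ⋃ α, SliceRegular.sphere (x α) (y α), SliceRegular.stemExt h,
    ⟨hdom, Set.sdiff_subset, hreg, ?_⟩, fun α => ?_, ?_⟩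
  · rintro p ⟨hp, hpΩ⟩
    have hlaurent : ∀ I ∈ SliceRegular.imaginaryUnits, p ∈ SliceRegular.slicePlane I →
        ∃ (a : ℤ → ℍ[ℝ]) (m : ℕ), SliceRegular.HasLaurentExpansion (SliceRegular.stemExt h)
          (Ω \ ⋃ α, SliceRegular.sphere (x α) (y α)) I p a ∧
          ∀ k : ℕ, m < k → a (-(k : ℤ)) = 0 := by
      intro I hI hpI
      obtain ⟨z, rfl⟩ := SliceRegular.mem_slicePlane_iff.1 hpI
      obtain ⟨α, -, hα⟩ : z ∈ SliceRegular.zeros x y Set.univ := by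
        rw [← SliceRegular.sliceMap_mem_iUnion_sphere_iff hI]
        by_contra hcon
        exact hpΩ ⟨hp, hcon⟩
      have hz : z ∈ SliceRegular.stemDomain Ω \ SliceRegular.zeros x y {α}ᶜ :=
        ⟨SliceRegular.mem_stemDomain_of_quad hS α z hα, SliceRegular.notMem_zeros_compl hS hα⟩
      have hmer := fun k =>
        SliceRegular.meromorphicAt_of_polePart (hopen _) (hg k α) (hgh k α) hz
      refine SliceRegular.hasLaurentExpansion_stemExt hconj (fun k => (hmer k).1) hI ?_
      filter_upwards [(hmer 0).2] with w hw
      exact (SliceRegular.sliceMap_mem_diff_iff hΩ hI).2 hw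
    -- All spheres were removed, including those with zero principal part; the finite Laurent tail
    -- leaves only this dichotomy.
    by_cases hext : SliceRegular.ExtendsRegularlyAt (SliceRegular.stemExt h)
        (Ω \ ⋃ α, SliceRegular.sphere (x α) (y α)) p
    · refine Or.inr ⟨fun I hI hpI => ?_, hext⟩
      obtain ⟨a, -, ha, -⟩ := hlaurent I hI hpI
      exact ⟨a, ha⟩
    · exact Or.inl ⟨hext, hlaurent⟩
  · exact SliceRegular.hasPrincipalPart_stemExt hΩ hS hconj α (q α) (m α) (A α)
      (fun k => hgconj k α) (fun k => hg k α) (fun k => hgh k α)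
  · intro p hp hpole
    by_contra hcon
    have hpΩ : p ∈ Ω \ ⋃ α, SliceRegular.sphere (x α) (y α) :=
      ⟨hp, fun hU => hcon (Set.mem_iUnion.1 hU)⟩
    -- Off the spheres the function is its own regular extension.
    exact hpole.1 ⟨_, SliceRegular.stemExt h, hdom.isOpen, hpΩ, hreg, fun _ _ => rfl⟩
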